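/- Use $\oplus=\max$ and $\odot=+$ on $\mathbb{R}$, and identify $\mathbb{R}^4/\mathbb{R}(1,1,1,1)$ with $\mathbb{R}^3$ by working in $X_4=0$. For a real $4\times4$ matrix $A=(a_{ij})$ let $\operatorname{span}(A)\subset\mathbb{R}^3$ be the tropical span of its columns. Let $A$ be a Kleene star ($a_{ii}=0$, $A\odot A=A$) such that (hypothesis 1) no tropical plane contains all four columns and (hypothesis 2) every $2\times2$ minor of $A$ involving three or four different indices is tropically regular (the maximum in its tropical determinant is attained once). Notation. $L_{ij}$ is the tropical line through columns $i,j$; with $m_{ab}$ the tropical $2\times 2$ minors of these two columns, $L_{ij}$ has type $[ab,cd]$ if $m_{ab}+m_{cd}<m_{ac}+m_{bd}=m_{ad}+m_{bc}$. The type-vector is $t=(t_1,t_2,t_3)$, $t_j$ being the number of lines $L_{ik}$ ($i<k$) of type $[4j,kl]$, $\{j,k,l\}=\{1,2,3\}$; it is considered up to a permutation. The extremals are the columns (generators) $\underline 1,\dots,\underline 4$, the vertices $\underline{ijk}$ of the tropical planes through three columns (given by the tropical Cramer rule), and the vertices of the lines $L_{ij}$. The polygon-vector is $(f_3,f_4,f_5,f_6)$,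 $f_m$ being the number of facets that are $m$-gons; two facets are adjacent if they share an edge. The configuration at $\underline{123}$ or $\underline4$ is $(p_1.p_2.p_3)$ if the facet through that point in the plane $X_i=\mathrm{const}$ is a $p_i$-gon. A configuration $(5.5.5)$ at $\underline{123}$ is left (right) if, for each $i\in\{1,2,3\}$, the pentagon in $X_i=\mathrm{const}$ contains both vertices of $L_{i,i-1}$ (of $L_{i,i+1}$); at $\underline4$ it is left (right) if it contains both vertices of $L_{4,i-1}$ (of $L_{4,i+1}$); here $i\pm1$ is taken modulo 3. A change of coordinates is a permutation of the four homogeneous coordinates (applied simultaneously to rows and columns of $A$); it preserves orientation if the permutation is even. It matches the combinatorial types of $\operatorname{span}(A)$ and $\operatorname{span}(B)$ if, for a permutation $\sigma$, some isomorphism of face lattices sends, for all $i\ne j$, the face $X_i-X_j=a_{ij}$ to the face $X_{\sigma(i)}-X_{\sigma(j)}=b_{\sigma(i)\sigma(j)}$. (a) $\operatorname{span}(A)$ is convex and maximal: it has 20 extremals, they are exactly its vertices, and its f-vector is $(20,30,12)$. (b) $A$ belongs to exactly one of the following classes; moreover $A$ belongs to a given class if and only if its type-vector and the number and adjacency of its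 hexagonal facets are those listed, and then its polygon-vector is the listed one. - Class 1: $t=(2,2,2)$. Three hexagons, no two adjacent; $(0,3,6,3)$. - Class 2: $t=(3,2,1)$ and the two lines of the type occurring exactly twice have concatenated indices ($L_{ij},L_{jk}$). Three hexagons, exactly one pair adjacent; $(0,3,6,3)$. - Class 3: $t=(3,2,1)$ and the two lines of the type occurring exactly twice have disjoint indices ($L_{ij},L_{kl}$). Two hexagons, adjacent; $(0,2,8,2)$. - Class 4: $t=(3,3,0)$. Four hexagons, forming two disjoint pairs of adjacent ones, with no other adjacencies; $(0,4,4,4)$. - Class 5: $t=(4,1,1)$. Four hexagons, whose adjacency graph is a 4-cycle; $(0,4,4,4)$. One of the configurations at $\underline{123}$ and $\underline4$ is a permutation of $(4.5.6)$ and the other arises from it by exchanging two entries. - Class 6: $t=(4,2,0)$. Four hexagons, whose adjacency graph is a 4-cycle; $(0,4,4,4)$. The two lines of the type occurring exactly twice have disjoint indices. The configurations at $\underline{123}$ and $\underline4$ are equal, and are a permutation of $(4.5.6)$. (Classes 5 and 6 have the same hexagon pattern and are distinguished by $t$.) (c) All six classes occur. For $A,B$ as above, the following are equivalent: $A$ and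 $B$ are in the same class; $\operatorname{span}(A)$ and $\operatorname{span}(B)$ have isomorphic face lattices; some change of coordinates matches the combinatorial types of $\operatorname{span}(A)$ and $\operatorname{span}(B)$. (d) Central symmetry: if $\operatorname{span}(A)$ has a centre of symmetry, then $A$ is in class 6; and class 6 contains centrally symmetric solids. (e) Chirality: $\operatorname{span}(A^t)=-\operatorname{span}(A)$. Call $\operatorname{span}(A)$ chiral if no orientation-preserving change of coordinates matches its combinatorial type with that of its mirror image $\operatorname{span}(A^t)$. Then $\operatorname{span}(A)$ is chiral if and only if $A$ is in class 1. Moreover $A$ is in class 1 if and only if, after some orientation-preserving change of coordinates, $\underline{123}$ and $\underline4$ are both $(5.5.5)$ left or both $(5.5.5)$ right; exactly one of these alternatives occurs for a given $A$ in class 1, and it is left for $A$ if and only if it is right for $A^t$. -/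

import Mathlib

/-! ### Tropical linear algebra (`max` and `+` over `ℝ`) -/

/-- Tropical product of two matrices of order 4. -/
noncomputable def tropMul (A B : Matrix (Fin 4) (Fin 4) ℝ) : Matrix (Fin 4) (Fin 4) ℝ :=
  Matrix.of fun i j => Finset.univ.sup' Finset.univ_nonempty fun k => A i k + B k j

/-- A Kleene star: zero diagonal and tropically idempotent. -/
structure IsKleeneStar (A : Matrix (Fin 4) (Fin 4) ℝ) : Prop where
  diag : ∀ i, A i i = 0
  idem : tropMul A A = A

/-- Tropical determinant. -/
noncomputable def tropDet {n : ℕ} (M : Matrix (Fin n) (Fin n) ℝ) : ℝ :=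
  Finset.univ.sup' Finset.univ_nonempty fun s : Equiv.Perm (Fin n) => ∑ i, M i (s i)

/-- Tropically regular: the maximum in the tropical determinant is attained only once. -/
def TropRegular {n : ℕ} (M : Matrix (Fin n) (Fin n) ℝ) : Prop :=
  ∃ s : Equiv.Perm (Fin n), ∀ t : Equiv.Perm (Fin n), t ≠ s →
    ∑ i, M i (t i) < ∑ i, M i (s i)

/-- The maximum of the family `f` is attained at least twice. -/
def MaxAttainedTwice {n : ℕ} (f : Fin n → ℝ) : Prop :=
  ∃ i j, i ≠ j ∧ f i = f j ∧ ∀ k, f k ≤ f i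

/-- The tropical plane with coefficients `a` (in homogeneous coordinates). -/
def tropPlane (a : Fin 4 → ℝ) : Set (Fin 4 → ℝ) :=
  {x | MaxAttainedTwice fun i => a i + x i}

/-- Hypothesis 1: the four columns of `A` are tropically non-coplanar. -/
def NonCoplanar (A : Matrix (Fin 4) (Fin 4) ℝ) : Prop :=
  ¬ ∃ a : Fin 4 → ℝ, ∀ j, A.col j ∈ tropPlane a

/-- Hypothesis 2: all `2 × 2` minors of `A` (rows `k, l`, columns `i, j`) which involve at least
three different indices are tropically regular. -/
def RegularMinors (A : Matrix (Fin 4) (Fin 4) ℝ) : Prop :=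
  ∀ k l i j : Fin 4, k ≠ l → i ≠ j → 3 ≤ ({k, l, i, j} : Finset (Fin 4)).card →
    TropRegular (A.submatrix ![k, l] ![i, j])

/-- The matrices under consideration: Kleene stars satisfying hypotheses 1 and 2. -/
structure Admissible (A : Matrix (Fin 4) (Fin 4) ℝ) : Prop where
  kleene : IsKleeneStar A
  hyp1 : NonCoplanar A
  hyp2 : RegularMinors A

/-- The identification of the tropical projective space `ℝ⁴ / ℝ(1,1,1,1)` with `ℝ³`
(work in `X₄ = 0`). -/
def dehom (x : Fin 4 → ℝ) : Fin 3 → ℝ := fun i => x i.castSucc - x 3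

/-- The representative with `X₄ = 0` of a point of `ℝ³`. -/
def homog (y : Fin 3 → ℝ) : Fin 4 → ℝ := Fin.snoc (α := fun _ => ℝ) y 0

/-- The tropical span of the columns of `A`, as a subset of `ℝ³`. -/
def tropSpan (A : Matrix (Fin 4) (Fin 4) ℝ) : Set (Fin 3 → ℝ) :=
  {y | ∃ c : Fin 4 → ℝ,
    y = dehom fun i => Finset.univ.sup' Finset.univ_nonempty fun j => c j + A i j}

/-! ### Tropical lines, their types and vertices -/

/-- The tropical `2 × 2` minor of the matrix with columns `p, q` on the rows `a, b`. -/
noncomputable def minor (p q : Fin 4 → ℝ) (a b : Fin 4) : ℝ :=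
  tropDet !![p a, q a; p b, q b]

/-- `m₄ⱼ + mₖₗ`, where `{j, k, l} = {1, 2, 3}`. -/
noncomputable def pluckerTerm (p q : Fin 4 → ℝ) (j : Fin 3) : ℝ :=
  minor p q 3 j.castSucc + minor p q (j + 1).castSucc (j + 2).castSucc

/-- The tropical line through `p` and `q` has type `[4j, kl]`, where `{j, k, l} = {1, 2, 3}`. -/
def LineHasType (p q : Fin 4 → ℝ) (j : Fin 3) : Prop :=
  pluckerTerm p q j < pluckerTerm p q (j + 1) ∧
    pluckerTerm p q (j + 1) = pluckerTerm p q (j + 2)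

/-- The terms in the expansion along the last column of the tropical `3 × 3` minor, with row `j`
omitted, of the matrix with columns `p, q, x`: each one is a coordinate of `x` other than `xⱼ`
plus the minor of `p, q` on the two remaining rows. -/
noncomputable def expansionTerm (p q x : Fin 4 → ℝ) (j : Fin 4) (i : Fin 3) : ℝ :=
  x (j.succAbove i) +
    minor p q (j.succAbove (i.succAbove 0)) (j.succAbove (i.succAbove 1))

/-- The tropical line through `p` and `q` (in homogeneous coordinates). -/
def tropLine (p q : Fin 4 → ℝ) : Set (Fin 4 → ℝ) :=
  {x | ∀ j, MaxAttainedTwice (expansionTerm p q x j)}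

/-- The ray of the tropical line through `p` and `q` in the `j`-th negative coordinate direction:
the points of the line all of whose coordinates but the `j`-th are prescribed by the minors
(as `xₖ = -mₐᵦ`, with `{j, k, a, b} = {1, 2, 3, 4}`), up to an additive constant. -/
def lineRay (p q : Fin 4 → ℝ) (j : Fin 4) : Set (Fin 4 → ℝ) :=
  {x | x ∈ tropLine p q ∧ ∀ i i', expansionTerm p q x j i = expansionTerm p q x j i'}

/-- The vertices of the tropical line through `p` and `q`: the points where two rays meet. -/
def lineVertices (p q : Fin 4 → ℝ) : Set (Fin 3 → ℝ) :=
  dehom '' {x | ∃ i j, i ≠ j ∧ x ∈ lineRay p q i ∧ x ∈ lineRay p q j}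

/-- The vertex of the tropical plane through the three columns of `A` other than the `l`-th,
by the tropical Cramer rule. -/
noncomputable def planeVertex (A : Matrix (Fin 4) (Fin 4) ℝ) (l : Fin 4) : Fin 3 → ℝ :=
  dehom fun i => - tropDet (A.submatrix i.succAbove l.succAbove)

/-- The generators of the span. -/
def generator (A : Matrix (Fin 4) (Fin 4) ℝ) (j : Fin 4) : Fin 3 → ℝ := dehom (A.col j)

/-- The extremals: generators, vertices of the tropical planes through three generators, vertices
of the tropical lines through two generators. -/
def extremals (A : Matrix (Fin 4) (Fin 4) ℝ) : Set (Fin 3 → ℝ) :=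
  Set.range (generator A) ∪ Set.range (planeVertex A) ∪
    {v | ∃ i j, i ≠ j ∧ v ∈ lineVertices (A.col i) (A.col j)}

/-- The line `L_ij` through the columns `i` and `j` of `A` has type `[4s, kl]`. -/
def LType (A : Matrix (Fin 4) (Fin 4) ℝ) (i j : Fin 4) (s : Fin 3) : Prop :=
  LineHasType (A.col i) (A.col j) s

/-- The type-vector: its `s`-th entry is the number of lines `L_ij`, `i < j`, of type
`[4s, kl]`. -/
noncomputable def typeVector (A : Matrix (Fin 4) (Fin 4) ℝ) : Fin 3 → ℕ :=
  fun s => {e : Fin 4 × Fin 4 | e.1 < e.2 ∧ LType A e.1 e.2 s}.ncard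

/-- Two lines with concatenated indices (`L_ij` and `L_jk`) have type `s`. -/
def ConcatenatedLines (A : Matrix (Fin 4) (Fin 4) ℝ) (s : Fin 3) : Prop :=
  ∃ i j k : Fin 4, i ≠ j ∧ j ≠ k ∧ i ≠ k ∧ LType A i j s ∧ LType A j k s

/-- Two lines with disjoint indices (`L_ij` and `L_kl`, `{i, j, k, l} = {1, 2, 3, 4}`) have
type `s`. -/
def DisjointLines (A : Matrix (Fin 4) (Fin 4) ℝ) (s : Fin 3) : Prop :=
  ∃ i j k l : Fin 4, i ≠ j ∧ i ≠ k ∧ i ≠ l ∧ j ≠ k ∧ j ≠ l ∧ k ≠ l ∧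
    LType A i j s ∧ LType A k l s

/-! ### Faces of convex bodies in `ℝ³` -/

/-- The faces of `P` (including the empty one and `P` itself), ordered by inclusion. -/
abbrev FaceLattice (P : Set (Fin 3 → ℝ)) : Type := {F : Set (Fin 3 → ℝ) // IsExposed ℝ P F}

/-- `F` is a non-empty face of `P` of dimension `d`. -/
def IsFaceOfDim (P : Set (Fin 3 → ℝ)) (d : ℕ) (F : Set (Fin 3 → ℝ)) : Prop :=
  IsExposed ℝ P F ∧ F.Nonempty ∧ Module.finrank ℝ (vectorSpan ℝ F) = d

/-- The f-vector: numbers of vertices, edges and facets. -/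
noncomputable def fVector (P : Set (Fin 3 → ℝ)) : Fin 3 → ℕ :=
  fun d => {F | IsFaceOfDim P d F}.ncard

/-- `F` is a facet of `P` and an `m`-gon. -/
def IsPolygonFacet (P : Set (Fin 3 → ℝ)) (m : ℕ) (F : Set (Fin 3 → ℝ)) : Prop :=
  IsFaceOfDim P 2 F ∧ (Set.extremePoints ℝ F).ncard = m

/-- The polygon-vector `(f₃, f₄, f₅, f₆)`. -/
noncomputable def polygonVector (P : Set (Fin 3 → ℝ)) : Fin 4 → ℕ :=
  fun m => {F | IsPolygonFacet P (m + 3) F}.ncard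

/-- The hexagonal facets of `P`, two of them joined when they are adjacent (share an edge). -/
def hexagonGraph (P : Set (Fin 3 → ℝ)) : SimpleGraph {F // IsPolygonFacet P 6 F} where
  Adj F G := F ≠ G ∧ IsFaceOfDim P 1 (F.1 ∩ G.1)
  symm := ⟨fun F G h => ⟨h.1.symm, by rw [Set.inter_comm]; exact h.2⟩⟩
  loopless := ⟨fun _ h => h.1 rfl⟩

/-- Same combinatorial type: isomorphic face lattices. -/
def CombEquiv (P Q : Set (Fin 3 → ℝ)) : Prop := Nonempty (FaceLattice P ≃o FaceLattice Q)

/-- `P` has a centre of symmetry. -/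
def CentrallySymmetric (P : Set (Fin 3 → ℝ)) : Prop :=
  ∃ c : Fin 3 → ℝ, ∀ y ∈ P, (2 : ℝ) • c - y ∈ P

/-! ### Configurations, handedness, chirality -/

/-- The intersection of the span of `A` with the classical plane `X_i - X_j = a_ij`
(where `X₄ = 0`). -/
def spanFace (A : Matrix (Fin 4) (Fin 4) ℝ) (i j : Fin 4) : Set (Fin 3 → ℝ) :=
  {y | y ∈ tropSpan A ∧ homog y i - homog y j = A i j}

/-- The change of coordinates that permutes the homogeneous coordinates by `s` matches the
combinatorial types of the spans of `A` and `B`: some isomorphism of face lattices sends, for all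
`i ≠ j`, the face in the plane `X_i - X_j = a_ij` to the face in the plane
`X_{s i} - X_{s j} = b_{s i, s j}`. -/
def CoordEquiv (s : Equiv.Perm (Fin 4)) (A B : Matrix (Fin 4) (Fin 4) ℝ) : Prop :=
  ∃ e : FaceLattice (tropSpan A) ≃o FaceLattice (tropSpan B),
    ∀ i j : Fin 4, i ≠ j → ∀ F : FaceLattice (tropSpan A),
      F.1 = spanFace A i j ↔ (e F).1 = spanFace B (s i) (s j)

/-- The span of `A` is chiral: no orientation-preserving change of coordinates (even permutation
of the homogeneous coordinates) matches its combinatorial type with that of its mirror image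
`-span(A)`, which is `span(Aᵀ)` when `A` is a Kleene star. -/
def IsChiral (A : Matrix (Fin 4) (Fin 4) ℝ) : Prop :=
  ¬ ∃ s : Equiv.Perm (Fin 4), Equiv.Perm.sign s = 1 ∧ CoordEquiv s A A.transpose

/-- The point `123`: the vertex of the tropical plane through the first three generators. -/
noncomputable def point123 (A : Matrix (Fin 4) (Fin 4) ℝ) : Fin 3 → ℝ := planeVertex A 3

/-- The point `4`: the fourth generator. -/
def point4 (A : Matrix (Fin 4) (Fin 4) ℝ) : Fin 3 → ℝ := generator A 3

/-- The configuration `(p₁.p₂.p₃)` at the point `v`: the facet of the span of `A` through `v` in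
the plane `X_i = const` is a `p_i`-gon. -/
noncomputable def configuration (A : Matrix (Fin 4) (Fin 4) ℝ) (v : Fin 3 → ℝ) : Fin 3 → ℕ :=
  fun i => (Set.extremePoints ℝ {y | y ∈ tropSpan A ∧ y i = v i}).ncard

/-- The configuration at `point123 A` is `(5.5.5)` left: three pentagons meet there, and the one
in the plane `X_i = const` contains both vertices of the line `L_{i,i-1}` (indices modulo 3). -/
def LeftAt123 (A : Matrix (Fin 4) (Fin 4) ℝ) : Prop :=
  ∀ i : Fin 3, configuration A (point123 A) i = 5 ∧
    lineVertices (A.col i.castSucc) (A.col (i - 1).castSucc) ⊆ {y | y i = point123 A i}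

/-- The configuration at `point123 A` is `(5.5.5)` right: three pentagons meet there, and the one
in the plane `X_i = const` contains both vertices of the line `L_{i,i+1}` (indices modulo 3). -/
def RightAt123 (A : Matrix (Fin 4) (Fin 4) ℝ) : Prop :=
  ∀ i : Fin 3, configuration A (point123 A) i = 5 ∧
    lineVertices (A.col i.castSucc) (A.col (i + 1).castSucc) ⊆ {y | y i = point123 A i}

/-- The configuration at `point4 A` is `(5.5.5)` left: three pentagons meet there, and the one
in the plane `X_i = const` contains both vertices of the line `L_{4,i-1}` (indices modulo 3). -/
def LeftAt4 (A : Matrix (Fin 4) (Fin 4) ℝ) : Prop :=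
  ∀ i : Fin 3, configuration A (point4 A) i = 5 ∧
    lineVertices (A.col 3) (A.col (i - 1).castSucc) ⊆ {y | y i = point4 A i}

/-- The configuration at `point4 A` is `(5.5.5)` right: three pentagons meet there, and the one
in the plane `X_i = const` contains both vertices of the line `L_{4,i+1}` (indices modulo 3). -/
def RightAt4 (A : Matrix (Fin 4) (Fin 4) ℝ) : Prop :=
  ∀ i : Fin 3, configuration A (point4 A) i = 5 ∧
    lineVertices (A.col 3) (A.col (i + 1).castSucc) ⊆ {y | y i = point4 A i}

/-- After an orientation-preserving change of coordinates, the points `123` and `4` are both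
`(5.5.5)` left. -/
def LeftHanded (A : Matrix (Fin 4) (Fin 4) ℝ) : Prop :=
  ∃ s : Equiv.Perm (Fin 4), Equiv.Perm.sign s = 1 ∧
    LeftAt123 (A.submatrix s s) ∧ LeftAt4 (A.submatrix s s)

/-- After an orientation-preserving change of coordinates, the points `123` and `4` are both
`(5.5.5)` right. -/
def RightHanded (A : Matrix (Fin 4) (Fin 4) ℝ) : Prop :=
  ∃ s : Equiv.Perm (Fin 4), Equiv.Perm.sign s = 1 ∧
    RightAt123 (A.submatrix s s) ∧ RightAt4 (A.submatrix s s)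

/-! ### The six classes -/

/-- Labels of the six classes. -/
inductive TetraClass : Type
  | class1
  | class2
  | class3
  | class4
  | class5
  | class6

/-- The type-vector of each class, up to a permutation. -/
def TetraClass.types : TetraClass → Fin 3 → ℕ
  | .class1 => ![2, 2, 2]
  | .class2 => ![3, 2, 1]
  | .class3 => ![3, 2, 1]
  | .class4 => ![3, 3, 0]
  | .class5 => ![4, 1, 1]
  | .class6 => ![4, 2, 0]

/-- The polygon-vector of each class. -/
def TetraClass.polygons : TetraClass → Fin 4 → ℕ
  | .class1 => ![0, 3, 6, 3]
  | .class2 => ![0, 3, 6, 3]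
  | .class3 => ![0, 2, 8, 2]
  | .class4 => ![0, 4, 4, 4]
  | .class5 => ![0, 4, 4, 4]
  | .class6 => ![0, 4, 4, 4]

/-- The number and adjacency of hexagons in each class: three hexagons, no two adjacent; three
hexagons, exactly two of them adjacent; two adjacent hexagons; two disjoint pairs of adjacent
hexagons; a cycle of four hexagons (twice). -/
def HexagonPattern (P : Set (Fin 3 → ℝ)) : TetraClass → Prop
  | .class1 => Nonempty (hexagonGraph P ≃g (⊥ : SimpleGraph (Fin 3)))
  | .class2 => Nonempty (hexagonGraph P ≃g SimpleGraph.edge (0 : Fin 3) 1)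
  | .class3 => Nonempty (hexagonGraph P ≃g (⊤ : SimpleGraph (Fin 2)))
  | .class4 => Nonempty
      (hexagonGraph P ≃g (SimpleGraph.edge (0 : Fin 4) 1 ⊔ SimpleGraph.edge (2 : Fin 4) 3))
  | .class5 => Nonempty (hexagonGraph P ≃g SimpleGraph.cycleGraph 4)
  | .class6 => Nonempty (hexagonGraph P ≃g SimpleGraph.cycleGraph 4)

/-- The type-vector of `A` equals `t` up to a permutation. -/
def HasTypeVector (A : Matrix (Fin 4) (Fin 4) ℝ) (t : Fin 3 → ℕ) : Prop :=
  ∃ s : Equiv.Perm (Fin 3), typeVector A ∘ s = t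

/-- Membership in the six classes. In classes 2 and 3 the type shared by exactly two lines is
`s 1`. -/
def InClass (A : Matrix (Fin 4) (Fin 4) ℝ) : TetraClass → Prop
  | .class1 => HasTypeVector A ![2, 2, 2]
  | .class2 => ∃ s : Equiv.Perm (Fin 3), typeVector A ∘ s = ![3, 2, 1] ∧ ConcatenatedLines A (s 1)
  | .class3 => ∃ s : Equiv.Perm (Fin 3), typeVector A ∘ s = ![3, 2, 1] ∧ DisjointLines A (s 1)
  | .class4 => HasTypeVector A ![3, 3, 0]
  | .class5 => HasTypeVector A ![4, 1, 1]
  | .class6 => HasTypeVector A ![4, 2, 0]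

/-!
The span of a Kleene star `A` is the alcoved polytope `{X | X_i - X_j ≥ a_ij}`
(`IsKleeneStar.tropSpan_eq`). Regularity of the minors with three indices says that all triangle
inequalities `a_ij + a_jk ≤ a_ik` are strict; this already forces non-coplanarity. It also implies
that two inequalities `X_i - X_j ≥ a_ij` and `X_j - X_k ≥ a_jk` are never tight together. Hence a
face is given by a set of pairs `(i, j)` whose first indices are disjoint from its second indices:
a face of the root polytope of type `A₃`, the cuboctahedron with vertices `e_i - e_j`. Its eight
triangles give the generators and the vertices of the tropical planes. In each of its six squares
`{k, l} × {i, j}` only the diagonal with the larger of `a_ki + a_lj` and `a_kj + a_li` can be tight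
(they differ by regularity of the minors with four indices); the two halves of the square give the
two vertices of the tropical line `L_ij`, and the choice of diagonal is the type of `L_ij`.

So the span is a simple polytope with 12 facets, dual to the triangulation of the boundary of the
cuboctahedron by the six chosen diagonals, and its dual complex consists of the cliques of a graph
on the 12 pairs. `IsSimplePolyhedron` isolates what is needed of this: the exposed faces, their
dimensions, their numbers of vertices and the whole face lattice can be read off from the graph,
and an isomorphism of face lattices is the same as an isomorphism of graphs
(`IsSimplePolyhedron.exists_orderIso`, `IsSimplePolyhedron.exists_graphIso`).
`IsGenericStar.isSimplePolyhedron` applies this to the span.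

The choice of the six diagonals is a `Pattern`. The six differences compared add up to zero, which
rules out two of the 64 patterns, the cyclic ones (`IsGenericStar.isGood_patternOf`). All
assertions become statements about the 62 remaining patterns, which are decided by evaluation:
each pattern is a relabelling of one of six representatives
(`Pattern.exists_inClass_matches_rep`), and the representatives have dual graphs that are not
isomorphic, as their numbers of closed walks of length six differ
(`Pattern.closedWalkCount_rep`). Chirality and handedness are statements about relabellings by even
permutations. A centre of symmetry makes `A` symmetric up to a translation, so that complementary
lines have equal types, which leaves only class 6.
-/

/-! ### Patterns of diagonals -/

/-- The ordered pairs of different indices: they label the inequalities `X_i - X_j ≥ a_ij`. -/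
abbrev Root : Type := {p : Fin 4 × Fin 4 // p.1 ≠ p.2}

/-- The index `s` of the partition `{{4, s}, {k, l}}` of the four indices of which `{i, j}` is
a block (a junk value for `i = j`). -/
def pairing : Fin 4 → Fin 4 → Fin 3 :=
  ![![0, 2, 1, 0], ![2, 0, 0, 1], ![1, 0, 0, 2], ![0, 1, 2, 0]]

/-- A choice of types for the six lines `L_ij`. The line `L_{4,r}` has type `r + 1` if `u r` holds
and `r + 2` otherwise, with indices of types taken modulo 3; likewise `w r` for the complementary
line. (The type `r` is impossible for these two lines.) -/
structure Pattern : Type where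
  u : Fin 3 → Bool
  w : Fin 3 → Bool

namespace Pattern

/-- The type of the line `L_ij` (a junk value for `i = j`). -/
def lineType (s : Pattern) (i j : Fin 4) : Fin 3 :=
  if (if i = 3 ∨ j = 3 then s.u (pairing i j) else s.w (pairing i j)) = true then
    pairing i j + 1 else pairing i j + 2

theorem _root_.pairing_comm : ∀ i j, pairing i j = pairing j i := by decide

set_option synthInstance.maxHeartbeats 200000 in
set_option synthInstance.maxSize 1000 in
theorem _root_.pairing_compl : ∀ k i l j : Fin 4, k ≠ i → k ≠ l → k ≠ j → i ≠ l → i ≠ j → l ≠ j →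
    pairing l j = pairing k i := by decide

theorem _root_.pairing_ne : ∀ k i j : Fin 4, k ≠ i → k ≠ j → i ≠ j →
    pairing k i ≠ pairing k j := by decide

theorem lineType_comm (s : Pattern) (i j : Fin 4) : s.lineType i j = s.lineType j i := by
  simp only [lineType, pairing_comm i j, or_comm]

/-- The dual graph of a span with pattern `s`: two pairs `(k, i)` and `(l, j)` are adjacent if
`{k, l}` and `{i, j}` are disjoint and, in case of a diagonal of the square `{k, l} × {i, j}`, this
is the diagonal chosen, which means that `L_ij` has the type `[ki, lj]`. -/
def graph (s : Pattern) : SimpleGraph Root where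
  Adj f g := f ≠ g ∧ f.1.1 ≠ g.1.2 ∧ g.1.1 ≠ f.1.2 ∧
    (f.1.1 ≠ g.1.1 → f.1.2 ≠ g.1.2 → s.lineType f.1.2 g.1.2 = pairing f.1.1 f.1.2)
  symm := ⟨fun f g h => ⟨h.1.symm, h.2.2.1, h.2.1, fun h1 h2 => by
    rw [lineType_comm, h.2.2.2 h1.symm h2.symm]
    exact (pairing_compl _ _ _ _ f.2 h1.symm h.2.1 h.2.2.1.symm h2.symm g.2).symm⟩⟩
  loopless := ⟨fun _ h => h.1 rfl⟩

instance (s : Pattern) : DecidableRel s.graph.Adj := fun f g => by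
  unfold graph; infer_instance

/-- The six choices, in their cyclic orientation, are not all the same. -/
def IsGood (s : Pattern) : Prop :=
  (∃ r, s.u r = true ∨ s.w r = true) ∧ ∃ r, s.u r = false ∨ s.w r = false

/-- The number of lines of type `t`. -/
def typeCount (s : Pattern) (t : Fin 3) : ℕ :=
  (Finset.univ.filter fun e : Fin 4 × Fin 4 => e.1 < e.2 ∧ s.lineType e.1 e.2 = t).card

/-- Membership in the classes, read off from the pattern. -/
def InClass (s : Pattern) : TetraClass → Prop
  | .class1 => ∃ p : Equiv.Perm (Fin 3), s.typeCount ∘ p = ![2, 2, 2]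
  | .class2 => ∃ p : Equiv.Perm (Fin 3), s.typeCount ∘ p = ![3, 2, 1] ∧
      ∃ i j k : Fin 4, i ≠ j ∧ j ≠ k ∧ i ≠ k ∧ s.lineType i j = p 1 ∧ s.lineType j k = p 1
  | .class3 => ∃ p : Equiv.Perm (Fin 3), s.typeCount ∘ p = ![3, 2, 1] ∧
      ∃ i j k l : Fin 4, i ≠ j ∧ i ≠ k ∧ i ≠ l ∧ j ≠ k ∧ j ≠ l ∧ k ≠ l ∧
        s.lineType i j = p 1 ∧ s.lineType k l = p 1
  | .class4 => ∃ p : Equiv.Perm (Fin 3), s.typeCount ∘ p = ![3, 3, 0]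
  | .class5 => ∃ p : Equiv.Perm (Fin 3), s.typeCount ∘ p = ![4, 1, 1]
  | .class6 => ∃ p : Equiv.Perm (Fin 3), s.typeCount ∘ p = ![4, 2, 0]

/-- A pattern in each class. -/
def rep : TetraClass → Pattern
  | .class1 => ⟨![false, false, false], ![true, true, true]⟩
  | .class2 => ⟨![false, false, false], ![false, true, true]⟩
  | .class3 => ⟨![false, false, false], ![false, false, true]⟩
  | .class4 => ⟨![false, false, true], ![false, true, true]⟩
  | .class5 => ⟨![false, false, true], ![true, false, true]⟩
  | .class6 => ⟨![false, false, true], ![false, false, true]⟩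

end Pattern

instance : DecidableEq TetraClass := fun a b => by
  cases a <;> cases b <;> first | exact isTrue rfl | exact isFalse nofun

instance : Fintype TetraClass :=
  ⟨{.class1, .class2, .class3, .class4, .class5, .class6}, by rintro ⟨⟩ <;> simp⟩

namespace Pattern

instance (s : Pattern) : DecidablePred s.InClass := fun c => by
  cases c <;> unfold InClass <;> infer_instance

instance : DecidablePred IsGood := fun s => by unfold IsGood; infer_instance

/-- Reduces a statement about all patterns to 64 cases. -/
theorem of_forall_bool {P : Pattern → Prop}
    (h : ∀ a b c d e f : Bool, P ⟨![a, b, c], ![d, e, f]⟩) (s : Pattern) : P s := by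
  obtain ⟨u, w⟩ := s
  have := h (u 0) (u 1) (u 2) (w 0) (w 1) (w 2)
  rwa [show ![u 0, u 1, u 2] = u by ext i; fin_cases i <;> rfl,
    show ![w 0, w 1, w 2] = w by ext i; fin_cases i <;> rfl] at this

/-- A permutation of the four indices acts on the ordered pairs. -/
def _root_.rootPerm (p : Equiv.Perm (Fin 4)) : Equiv.Perm Root where
  toFun f := ⟨(p f.1.1, p f.1.2), fun h => f.2 (p.injective h)⟩
  invFun f := ⟨(p.symm f.1.1, p.symm f.1.2), fun h => f.2 (p.symm.injective h)⟩
  left_inv f := by simp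
  right_inv f := by simp

/-- Relabelling the indices by `p` turns the pattern `s` into `s'`. -/
def Matches (p : Equiv.Perm (Fin 4)) (s s' : Pattern) : Prop :=
  ∀ f g : Root, s.graph.Adj f g ↔ s'.graph.Adj (rootPerm p f) (rootPerm p g)

instance (p : Equiv.Perm (Fin 4)) (s s' : Pattern) : Decidable (Matches p s s') := by
  unfold Matches; infer_instance

theorem exists_inClass_forall_eq (s : Pattern) : s.IsGood →
    ∃ c, s.InClass c ∧ ∀ d, s.InClass d → d = c := by
  revert s; exact of_forall_bool (by decide +kernel)

theorem exists_inClass_matches_rep (s : Pattern) : s.IsGood →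
    ∃ c, s.InClass c ∧ ∃ p, Matches p (rep c) s := by
  revert s; exact of_forall_bool (by decide +kernel)

end Pattern

/-! ### Simple polyhedra and their faces -/

/-- The cliques of `G` as a type. -/
abbrev Cliques {I : Type*} (G : SimpleGraph I) : Type _ := {σ : Finset I // G.IsClique (σ : Set I)}

section Polyhedron

open Filter Topology

variable {V I : Type*} [NormedAddCommGroup V] [NormedSpace ℝ V]

/-- The polyhedron cut out by the inequalities `a f ≤ ℓ f y`. -/
def polyhedron (ℓ : I → StrongDual ℝ V) (a : I → ℝ) : Set V := {y | ∀ f, a f ≤ ℓ f y}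

/-- The face of the polyhedron on which the inequalities in `σ` are tight. -/
def polyhedronFace (ℓ : I → StrongDual ℝ V) (a : I → ℝ) (σ : Finset I) : Set V :=
  {y | y ∈ polyhedron ℓ a ∧ ∀ f ∈ σ, ℓ f y = a f}

/-- The polyhedron is simple, and its dual complex is the clique complex of `G`: inequalities
tight at a common point are adjacent in `G`, and every clique of `G` extends to a clique `τ` whose
inequalities are those tight at some vertex and whose functionals form a basis of the dual space
(stated as unique solvability). -/
structure IsSimplePolyhedron (ℓ : I → StrongDual ℝ V) (a : I → ℝ) (G : SimpleGraph I) : Prop where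
  adj_of_tight : ∀ y ∈ polyhedron ℓ a, ∀ f g, f ≠ g → ℓ f y = a f → ℓ g y = a g → G.Adj f g
  exists_vertex : ∀ σ : Finset I, G.IsClique (σ : Set I) → ∃ τ : Finset I, σ ⊆ τ ∧
    G.IsClique (τ : Set I) ∧ (∀ b : I → ℝ, ∃! x, ∀ f ∈ τ, ℓ f x = b f) ∧
    ∃ v ∈ polyhedron ℓ a, ∀ f, ℓ f v = a f ↔ f ∈ τ

theorem polyhedronFace_empty (ℓ : I → StrongDual ℝ V) (a : I → ℝ) :
    polyhedronFace ℓ a ∅ = polyhedron ℓ a := by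
  ext; simp [polyhedronFace]

theorem convex_polyhedron (ℓ : I → StrongDual ℝ V) (a : I → ℝ) : Convex ℝ (polyhedron ℓ a) := by
  have : polyhedron ℓ a = ⋂ f, {y | a f ≤ ℓ f y} := by ext; simp [polyhedron]
  rw [this]
  exact convex_iInter fun f => convex_halfSpace_ge (ℓ f).isLinear _

namespace IsSimplePolyhedron

variable [Fintype I] {ℓ : I → StrongDual ℝ V} {a : I → ℝ} {G : SimpleGraph I}

/-- Moving a point of the polyhedron by a small multiple of `d` keeps it inside, provided that `d`
does not decrease the functionals that are tight at the point; those increased by `d` stop being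
tight, and no others become tight. -/
theorem eventually_tight_iff (y d : V) (hy : y ∈ polyhedron ℓ a)
    (hd : ∀ f, ℓ f y = a f → 0 ≤ ℓ f d) :
    ∀ᶠ ε in 𝓝[>] (0 : ℝ), y + ε • d ∈ polyhedron ℓ a ∧
      ∀ f, ℓ f (y + ε • d) = a f ↔ ℓ f y = a f ∧ ℓ f d = 0 := by
  have key : ∀ f, ∀ᶠ ε in 𝓝[>] (0 : ℝ), a f ≤ ℓ f (y + ε • d) ∧
      (ℓ f (y + ε • d) = a f ↔ ℓ f y = a f ∧ ℓ f d = 0) := by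
    intro f
    by_cases hf : ℓ f y = a f
    · filter_upwards [self_mem_nhdsWithin] with ε hε
      have hε : 0 < ε := hε
      simp only [map_add, map_smul, smul_eq_mul, hf, true_and]
      refine ⟨by nlinarith [hd f hf], ?_⟩
      constructor
      · intro h
        have : ε * ℓ f d = 0 := by linarith
        exact (mul_eq_zero.1 this).resolve_left hε.ne'
      · intro h; simp [h]
    · have hlt : a f < ℓ f (y + (0 : ℝ) • d) := by
        simpa using lt_of_le_of_ne (hy f) (Ne.symm hf)
      have hc : Continuous fun ε : ℝ => ℓ f (y + ε • d) := by fun_prop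
      filter_upwards [nhdsWithin_le_nhds ((hc.tendsto 0).eventually (lt_mem_nhds hlt))] with ε hε
      exact ⟨hε.le, ⟨fun h => absurd h hε.ne', fun h => absurd h.1 hf⟩⟩
  filter_upwards [eventually_all.2 key] with ε hε
  exact ⟨fun f => (hε f).1, fun f => (hε f).2⟩

theorem exists_pos_tight_iff (y d : V) (hy : y ∈ polyhedron ℓ a)
    (hd : ∀ f, ℓ f y = a f → 0 ≤ ℓ f d) :
    ∃ ε : ℝ, 0 < ε ∧ y + ε • d ∈ polyhedron ℓ a ∧
      ∀ f, ℓ f (y + ε • d) = a f ↔ ℓ f y = a f ∧ ℓ f d = 0 := by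
  obtain ⟨ε, h1, h2⟩ := ((eventually_tight_iff y d hy hd).and self_mem_nhdsWithin).exists
  exact ⟨ε, h2, h1⟩

variable (h : IsSimplePolyhedron ℓ a G)
include h

/-- Every clique is the set of inequalities tight at some point. -/
theorem exists_tight_iff {σ : Finset I} (hσ : G.IsClique (σ : Set I)) :
    ∃ y ∈ polyhedron ℓ a, ∀ f, ℓ f y = a f ↔ f ∈ σ := by
  classical
  obtain ⟨τ, hστ, -, hb, v, hv, hvt⟩ := h.exists_vertex σ hσ
  obtain ⟨d, hd, -⟩ := hb fun f => if f ∈ σ then 0 else 1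
  obtain ⟨ε, -, h1, h2⟩ := exists_pos_tight_iff v d hv fun f hf => by
    rw [hd f ((hvt f).1 hf)]; split_ifs <;> norm_num
  refine ⟨_, h1, fun f => ?_⟩
  rw [h2, hvt]
  constructor
  · rintro ⟨h3, h4⟩
    by_contra h5
    simp [hd f h3, h5] at h4
  · intro h3
    exact ⟨hστ h3, by simp [hd f (hστ h3), h3]⟩

omit [Fintype I] in
theorem isClique_tight {y : V} (hy : y ∈ polyhedron ℓ a) {σ : Finset I}
    (hσ : ∀ f ∈ σ, ℓ f y = a f) : G.IsClique (σ : Set I) :=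
  fun f hf g hg hfg => h.adj_of_tight y hy f g hfg (hσ f hf) (hσ g hg)

theorem face_subset_face_iff {σ τ : Finset I} (hσ : G.IsClique (σ : Set I)) :
    polyhedronFace ℓ a σ ⊆ polyhedronFace ℓ a τ ↔ τ ⊆ σ := by
  constructor
  · intro hs f hf
    obtain ⟨y, hy, hyt⟩ := h.exists_tight_iff hσ
    exact (hyt f).1 ((hs ⟨hy, fun g hg => (hyt g).2 hg⟩).2 f hf)
  · exact fun hs y hy => ⟨hy.1, fun f hf => hy.2 f (hs hf)⟩

theorem face_nonempty_iff {σ : Finset I} :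
    (polyhedronFace ℓ a σ).Nonempty ↔ G.IsClique (σ : Set I) := by
  constructor
  · rintro ⟨y, hy⟩
    exact h.isClique_tight hy.1 hy.2
  · intro hσ
    obtain ⟨y, hy, hyt⟩ := h.exists_tight_iff hσ
    exact ⟨y, hy, fun g hg => (hyt g).2 hg⟩

omit h [Fintype I] in
theorem isExposed_face (σ : Finset I) :
    IsExposed ℝ (polyhedron ℓ a) (polyhedronFace ℓ a σ) := by
  rintro ⟨y₀, hy₀⟩
  refine ⟨-∑ f ∈ σ, ℓ f, ?_⟩
  ext y
  simp only [polyhedronFace, Set.mem_ofPred_eq, neg_apply,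
    FunLike.coe_sum, Finset.sum_apply, neg_le_neg_iff]
  refine and_congr_right fun hy => ⟨fun hyt z hz => ?_, fun hm f hf => ?_⟩
  · exact Finset.sum_le_sum fun f hf => (hyt f hf).le.trans (hz f)
  · have h1 := hm y₀ hy₀.1
    rw [Finset.sum_congr rfl hy₀.2] at h1
    exact ((Finset.sum_eq_sum_iff_of_le fun f _ => hy f).1
      (le_antisymm (Finset.sum_le_sum fun f _ => hy f) h1) f hf).symm

/-- The non-empty exposed faces are the faces given by the cliques: such a face is determined by
the inequalities tight at one of its points with fewest tight inequalities. -/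
theorem isExposed_iff {F : Set V} :
    IsExposed ℝ (polyhedron ℓ a) F ↔
      F = ∅ ∨ ∃ σ : Finset I, G.IsClique (σ : Set I) ∧ F = polyhedronFace ℓ a σ := by
  classical
  constructor
  · intro hF
    rcases F.eq_empty_or_nonempty with h0 | hne
    · exact Or.inl h0
    right
    obtain ⟨l, hl⟩ := hF hne
    -- `y` has the fewest tight inequalities; by looking at midpoints, they are tight
    -- on all of `F`.
    let T : V → Finset I := fun y => Finset.univ.filter fun f => ℓ f y = a f
    obtain ⟨y, hyF, hmin⟩ := exists_minimalFor_of_wellFoundedLT (· ∈ F) (fun y => (T y).card) hne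
    have hyP : y ∈ polyhedron ℓ a := hF.subset hyF
    have hmid : ∀ z ∈ F, ∀ f ∈ T y, ℓ f z = a f := by
      intro z hz
      have hzP : z ∈ polyhedron ℓ a := hF.subset hz
      have hm : (1 / 2 : ℝ) • y + (1 / 2 : ℝ) • z ∈ F :=
        (hF.convex (convex_polyhedron ℓ a)) hyF hz (by norm_num) (by norm_num) (by norm_num)
      have hT : T ((1 / 2 : ℝ) • y + (1 / 2 : ℝ) • z) ⊆ T y ∩ T z := by
        intro f hf
        simp only [T, Finset.mem_filter, Finset.mem_univ, true_and, map_add, map_smul, smul_eq_mul,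
          Finset.mem_inter] at hf ⊢
        constructor <;> linarith [hyP f, hzP f]
      have h1 : (T y).card ≤ (T y ∩ T z).card := by
        have h2 := Finset.card_le_card hT
        have h3 := hmin hm (h2.trans (Finset.card_le_card Finset.inter_subset_left))
        exact h3.trans h2
      have h2 := Finset.eq_of_subset_of_card_le Finset.inter_subset_left h1
      intro f hf
      rw [← h2] at hf
      exact (Finset.mem_filter.1 (Finset.mem_inter.1 hf).2).2
    refine ⟨T y, h.isClique_tight hyP fun f hf => (Finset.mem_filter.1 hf).2, ?_⟩
    ext z
    refine ⟨fun hz => ⟨hF.subset hz, hmid z hz⟩, fun hz => ?_⟩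
    rw [hl] at hyF ⊢
    refine ⟨hz.1, fun w hw => (hyF.2 w hw).trans ?_⟩
    -- The segment from `z` to `y` can be prolonged beyond `y`.
    obtain ⟨ε, hε, h1, -⟩ := exists_pos_tight_iff y (y - z) hyP fun f hf => by
      rw [map_sub, hf, hz.2 f (by simp [T, hf]), sub_self]
    have h2 := hyF.2 _ h1
    simp only [map_add, map_smul, map_sub, smul_eq_mul] at h2
    nlinarith
  · rintro (rfl | ⟨σ, -, rfl⟩)
    · rintro ⟨_, ⟨⟩⟩
    · exact isExposed_face σ

variable [FiniteDimensional ℝ V]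

theorem finrank_vectorSpan_face {σ : Finset I} (hσ : G.IsClique (σ : Set I)) :
    Module.finrank ℝ (vectorSpan ℝ (polyhedronFace ℓ a σ)) + σ.card = Module.finrank ℝ V := by
  obtain ⟨y, hy, hyt⟩ := h.exists_tight_iff hσ
  obtain ⟨τ, hστ, -, hb, -⟩ := h.exists_vertex σ hσ
  classical
  let φ : V →ₗ[ℝ] (σ → ℝ) := LinearMap.pi fun f => (ℓ f : V →ₗ[ℝ] ℝ)
  have hφ : Function.Surjective φ := by
    intro b
    obtain ⟨x, hx, -⟩ := hb fun f => if hf : f ∈ σ then b ⟨f, hf⟩ else 0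
    refine ⟨x, funext fun f => ?_⟩
    have := hx f (hστ f.2)
    simpa [φ] using this
  have hker : vectorSpan ℝ (polyhedronFace ℓ a σ) = LinearMap.ker φ := by
    apply le_antisymm
    · rw [vectorSpan, Submodule.span_le]
      rintro _ ⟨p, hp, q, hq, rfl⟩
      simp only [SetLike.mem_coe, LinearMap.mem_ker, vsub_eq_sub]
      funext f
      simp [φ, hp.2 f f.2, hq.2 f f.2]
    · intro d hd
      have hd0 : ∀ f ∈ σ, ℓ f d = 0 := fun f hf => congrFun (LinearMap.mem_ker.1 hd) ⟨f, hf⟩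
      obtain ⟨ε, hε, h1, h2⟩ := exists_pos_tight_iff y d hy fun f hf =>
        (hd0 f ((hyt f).1 hf)).ge
      have h3 : ε • d ∈ vectorSpan ℝ (polyhedronFace ℓ a σ) := by
        have := vsub_mem_vectorSpan ℝ (s := polyhedronFace ℓ a σ) (p₁ := y + ε • d) (p₂ := y)
          ⟨h1, fun f hf => (h2 f).2 ⟨(hyt f).2 hf, hd0 f hf⟩⟩ ⟨hy, fun f hf => (hyt f).2 hf⟩
        simpa using this
      have := Submodule.smul_mem _ ε⁻¹ h3
      rwa [smul_smul, inv_mul_cancel₀ hε.ne', one_smul] at this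
  rw [hker, add_comm, ← LinearMap.finrank_range_add_finrank_ker φ, LinearMap.range_eq_top.2 hφ,
    finrank_top, Module.finrank_fintype_fun_eq_card, Fintype.card_coe]

/-- A clique whose size is the dimension determines a vertex. -/
theorem existsUnique_of_card {σ : Finset I} (hσ : G.IsClique (σ : Set I))
    (hc : σ.card = Module.finrank ℝ V) :
    (∀ b : I → ℝ, ∃! x, ∀ f ∈ σ, ℓ f x = b f) ∧
    ∃ v ∈ polyhedron ℓ a, ∀ f, ℓ f v = a f ↔ f ∈ σ := by
  obtain ⟨τ, hστ, hτ, hb, hv⟩ := h.exists_vertex σ hσ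
  have h1 := h.finrank_vectorSpan_face hτ
  have : σ = τ := Finset.eq_of_subset_of_card_le hστ (by omega)
  subst this
  exact ⟨hb, hv⟩

theorem card_of_existsUnique {τ : Finset I} (hτ : G.IsClique (τ : Set I))
    (hb : ∀ b : I → ℝ, ∃! x, ∀ f ∈ τ, ℓ f x = b f) : τ.card = Module.finrank ℝ V := by
  have h1 := h.finrank_vectorSpan_face hτ
  have h2 : vectorSpan ℝ (polyhedronFace ℓ a τ) = ⊥ := by
    rw [vectorSpan_eq_bot_iff_subsingleton]
    intro x hx y hy
    exact (hb a).unique hx.2 hy.2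
  rw [h2, finrank_bot] at h1
  omega

/-- The extreme points of a face are its points at which as many inequalities are tight as the
dimension of the space. -/
theorem mem_extremePoints_face_iff {σ : Finset I} {v : V} :
    v ∈ Set.extremePoints ℝ (polyhedronFace ℓ a σ) ↔
      v ∈ polyhedronFace ℓ a σ ∧ ∃ τ : Finset I, τ.card = Module.finrank ℝ V ∧
        ∀ f, ℓ f v = a f ↔ f ∈ τ := by
  classical
  constructor
  · rintro ⟨hv, hext⟩
    refine ⟨hv, Finset.univ.filter fun f => ℓ f v = a f, ?_, by simp⟩
    set τ := Finset.univ.filter fun f => ℓ f v = a f with hτ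
    have hτt : ∀ f, ℓ f v = a f ↔ f ∈ τ := by simp [hτ]
    obtain ⟨τ', hs, hcl, hb, -⟩ := h.exists_vertex τ (h.isClique_tight hv.1 fun f => (hτt f).2)
    -- `v` can be moved both ways along `d`, so `d = 0` and no functional was missing from `τ`.
    obtain ⟨d, hd, -⟩ := hb fun f => if f ∈ τ then 0 else 1
    have hd0 : ∀ f, ℓ f v = a f → ℓ f d = 0 := fun f hf => by
      rw [hd f (hs ((hτt f).1 hf)), if_pos ((hτt f).1 hf)]
    obtain ⟨ε, ⟨⟨h1, h2⟩, h1', h2'⟩, hε⟩ := (((eventually_tight_iff v d hv.1 fun f hf =>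
      (hd0 f hf).ge).and (eventually_tight_iff v (-d) hv.1 fun f hf => by
        simp [hd0 f hf])).and self_mem_nhdsWithin).exists
    have hε : 0 < ε := hε
    have h3 := hext (x₁ := v + ε • d) (x₂ := v + ε • -d)
      ⟨h1, fun f hf => (h2 f).2 ⟨hv.2 f hf, hd0 f (hv.2 f hf)⟩⟩
      ⟨h1', fun f hf => (h2' f).2 ⟨hv.2 f hf, by simp [hd0 f (hv.2 f hf)]⟩⟩
      ⟨1 / 2, 1 / 2, by norm_num, by norm_num, by norm_num, by module⟩
    have hdz : d = 0 := by
      have h4 : ε • d = 0 := by simpa using h3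
      exact (smul_eq_zero.1 h4).resolve_left hε.ne'
    have : τ = τ' := by
      refine Finset.Subset.antisymm hs fun f hf => ?_
      have := hd f hf
      by_contra hn
      simp [hdz, hn] at this
    rw [this]
    exact h.card_of_existsUnique hcl hb
  · rintro ⟨hv, τ, hc, hτ⟩
    refine ⟨hv, fun x hx y hy hxy => ?_⟩
    obtain ⟨p, q, hp, hq, hpq, rfl⟩ := hxy
    have hcl : G.IsClique (τ : Set I) := h.isClique_tight hv.1 fun f => (hτ f).2
    obtain ⟨hb, -⟩ := h.existsUnique_of_card hcl hc
    refine (hb a).unique (fun f hf => ?_) fun f hf => (hτ f).2 hf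
    have h1 := (hτ f).2 hf
    simp only [map_add, map_smul, smul_eq_mul] at h1
    have h2 := hx.1 f
    have h3 := hy.1 f
    have h4 : p * (ℓ f x - a f) + q * (ℓ f y - a f) = 0 := by linear_combination h1 - a f * hpq
    have h5 : p * (ℓ f x - a f) = 0 := by
      apply le_antisymm
      · nlinarith [mul_nonneg hq.le (sub_nonneg.2 h3)]
      · exact mul_nonneg hp.le (sub_nonneg.2 h2)
    linarith [(mul_eq_zero.1 h5).resolve_left hp.ne']

/-- The number of vertices of a face. -/
theorem ncard_extremePoints_face (σ : Finset I) :
    (Set.extremePoints ℝ (polyhedronFace ℓ a σ)).ncard =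
      {τ : Finset I | G.IsNClique (Module.finrank ℝ V) τ ∧ σ ⊆ τ}.ncard := by
  classical
  refine Set.ncard_congr (fun v _ => Finset.univ.filter fun f => ℓ f v = a f) ?_ ?_ ?_
  · intro v hv
    obtain ⟨hv, τ, hc, hτ⟩ := h.mem_extremePoints_face_iff.1 hv
    have : (Finset.univ.filter fun f => ℓ f v = a f) = τ := by ext f; simp [hτ]
    rw [this]
    refine ⟨⟨h.isClique_tight hv.1 fun f => (hτ f).2, hc⟩, fun f hf => (hτ f).1 (hv.2 f hf)⟩
  · intro v w hv hw hvw
    obtain ⟨hv, τ, hc, hτ⟩ := h.mem_extremePoints_face_iff.1 hv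
    have h1 : (Finset.univ.filter fun f => ℓ f v = a f) = τ := by ext f; simp [hτ]
    have h2 : ∀ f, ℓ f w = a f ↔ f ∈ τ := fun f => by rw [← h1, hvw]; simp
    obtain ⟨hb, -⟩ := h.existsUnique_of_card (h.isClique_tight hv.1 fun f => (hτ f).2) hc
    exact (hb a).unique (fun f => (hτ f).2) fun f => (h2 f).2
  · rintro τ ⟨hτ, hs⟩
    obtain ⟨-, v, hv, hvt⟩ := h.existsUnique_of_card hτ.1 hτ.2
    refine ⟨v, h.mem_extremePoints_face_iff.2 ⟨⟨hv, fun f hf => (hvt f).2 (hs hf)⟩, τ, hτ.2, hvt⟩,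
      by ext f; simp [hvt]⟩

end IsSimplePolyhedron
end Polyhedron

/-! ### The face lattice of a simple polyhedron -/

section FaceLattice

variable {I : Type*} [Fintype I] {ℓ ℓ' : I → StrongDual ℝ (Fin 3 → ℝ)} {a a' : I → ℝ}
  {G G' : SimpleGraph I}

/-- The isomorphism of posets of cliques induced by an isomorphism of graphs. -/
def SimpleGraph.Iso.cliques {I J : Type*} {G : SimpleGraph I} {G' : SimpleGraph J} (e : G ≃g G') :
    Cliques G ≃o Cliques G' where
  toFun σ := ⟨σ.1.map e.toEquiv.toEmbedding, by
    rintro _ hx _ hy hxy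
    simp only [Finset.coe_map, Set.mem_image, Finset.mem_coe] at hx hy
    obtain ⟨x, hx, rfl⟩ := hx
    obtain ⟨y, hy, rfl⟩ := hy
    exact e.map_adj_iff.2 (σ.2 hx hy fun h => hxy (by rw [h]))⟩
  invFun σ := ⟨σ.1.map e.symm.toEquiv.toEmbedding, by
    rintro _ hx _ hy hxy
    simp only [Finset.coe_map, Set.mem_image, Finset.mem_coe] at hx hy
    obtain ⟨x, hx, rfl⟩ := hx
    obtain ⟨y, hy, rfl⟩ := hy
    exact e.symm.map_adj_iff.2 (σ.2 hx hy fun h => hxy (by rw [h]))⟩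
  left_inv σ := by
    ext x
    simp only [Finset.mem_map_equiv]
    exact (by rw [show e.toEquiv.symm (e.symm.toEquiv.symm x) = x from e.symm_apply_apply x])
  right_inv σ := by
    ext x
    simp only [Finset.mem_map_equiv]
    exact (by rw [show e.symm.toEquiv.symm (e.toEquiv.symm x) = x from e.apply_symm_apply x])
  map_rel_iff' := by
    intro σ τ
    exact Finset.map_subset_map

/-- The facet in the plane where the inequality `f` is tight. -/
def facetOf (ℓ : I → StrongDual ℝ (Fin 3 → ℝ)) (a : I → ℝ) (f : I) :
    FaceLattice (polyhedron ℓ a) :=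
  ⟨polyhedronFace ℓ a {f}, IsSimplePolyhedron.isExposed_face _⟩

omit [Fintype I] in
theorem isClique_singleton (G : SimpleGraph I) (f : I) :
    G.IsClique (({f} : Finset I) : Set I) := by simp

namespace IsSimplePolyhedron

/-- The face lattice is the lattice of cliques, reversed, with a least element (the empty face)
adjoined. -/
noncomputable def faceLatticeIso (h : IsSimplePolyhedron ℓ a G) :
    WithBot (Cliques G)ᵒᵈ ≃o FaceLattice (polyhedron ℓ a) :=
  RelIso.ofSurjective
    (OrderEmbedding.ofMapLEIff
      (fun x => match x with
        | ⊥ => (⟨∅, h.isExposed_iff.2 (Or.inl rfl)⟩ : FaceLattice (polyhedron ℓ a))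
        | (σ : (Cliques G)ᵒᵈ) => ⟨polyhedronFace ℓ a (OrderDual.ofDual σ).1, isExposed_face _⟩)
      (by
        rintro (_ | σ) (_ | τ)
        · simp only [le_refl, true_iff]; exact le_rfl
        · exact ⟨fun _ => bot_le, fun _ => Set.empty_subset _⟩
        · refine ⟨fun hs => ?_, fun hs => absurd hs (WithBot.not_coe_le_bot _)⟩
          obtain ⟨y, hy⟩ := h.face_nonempty_iff.2 (OrderDual.ofDual σ).2
          exact (hs hy).elim
        · refine Iff.trans (h.face_subset_face_iff (OrderDual.ofDual σ).2) ?_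
          exact Iff.symm (WithBot.coe_le_coe (a := σ) (b := τ))))
    (by
      rintro ⟨F, hF⟩
      rcases h.isExposed_iff.1 hF with rfl | ⟨σ, hσ, rfl⟩
      · exact ⟨⊥, rfl⟩
      · exact ⟨((OrderDual.toDual ⟨σ, hσ⟩ : (Cliques G)ᵒᵈ) : WithBot (Cliques G)ᵒᵈ), rfl⟩)

theorem faceLatticeIso_singleton (h : IsSimplePolyhedron ℓ a G) (f : I) :
    h.faceLatticeIso ((OrderDual.toDual ⟨{f}, isClique_singleton G f⟩ : (Cliques G)ᵒᵈ) :
      WithBot (Cliques G)ᵒᵈ) = facetOf ℓ a f := rfl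

/-- An isomorphism of the dual graphs induces one of the face lattices. -/
theorem exists_orderIso (h : IsSimplePolyhedron ℓ a G) (h' : IsSimplePolyhedron ℓ' a' G')
    (p : G ≃g G') :
    ∃ e : FaceLattice (polyhedron ℓ a) ≃o FaceLattice (polyhedron ℓ' a'),
      ∀ f, e (facetOf ℓ a f) = facetOf ℓ' a' (p f) := by
  refine ⟨h.faceLatticeIso.symm.trans (p.cliques.dual.withBotCongr.trans h'.faceLatticeIso),
    fun f => ?_⟩
  rw [← h.faceLatticeIso_singleton, ← h'.faceLatticeIso_singleton]
  simp only [OrderIso.trans_apply, OrderIso.symm_apply_apply]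
  congr 1

theorem face_singleton_injective (h : IsSimplePolyhedron ℓ a G) {f g : I}
    (hfg : polyhedronFace ℓ a {f} = polyhedronFace ℓ a {g}) : f = g := by
  have h1 := (h.face_subset_face_iff (τ := {g}) (isClique_singleton G f)).1 hfg.le
  exact (Finset.singleton_subset_singleton.1 h1).symm

theorem facetOf_injective (h : IsSimplePolyhedron ℓ a G) : Function.Injective (facetOf ℓ a) :=
  fun _ _ hfg => h.face_singleton_injective (Subtype.ext_iff.1 hfg)

omit [Fintype I] in
theorem isTop_iff (F : FaceLattice (polyhedron ℓ a)) :
    IsTop F ↔ F.1 = polyhedron ℓ a := by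
  constructor
  · intro hF
    have h0 := polyhedronFace_empty ℓ a
    have := hF ⟨polyhedronFace ℓ a ∅, isExposed_face _⟩
    exact F.2.subset.antisymm (h0.ge.trans this)
  · intro hF F'
    change F'.1 ⊆ F.1
    rw [hF]; exact F'.2.subset

/-- The facets are the coatoms of the face lattice. -/
theorem covBy_top_iff [Nonempty I] (h : IsSimplePolyhedron ℓ a G)
    (F : FaceLattice (polyhedron ℓ a)) :
    (∃ t, IsTop t ∧ F ⋖ t) ↔ ∃ f, F = facetOf ℓ a f := by
  have h0 := polyhedronFace_empty ℓ a
  have hlt : ∀ f t, IsTop t → facetOf ℓ a f < t := by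
    intro f t ht
    refine lt_of_le_of_ne (ht _) fun he => ?_
    have h1 := (isTop_iff _).1 (he ▸ ht)
    have h2 := (h.face_subset_face_iff (σ := ∅) (τ := {f}) (by simp)).1 (by rw [h0]; exact h1.ge)
    simp at h2
  constructor
  · rintro ⟨t, ht, hFt, hc⟩
    suffices ∃ f, F ≤ facetOf ℓ a f by
      obtain ⟨f, hf⟩ := this
      exact ⟨f, hf.eq_or_lt.resolve_right fun hlt' => hc hlt' (hlt f t ht)⟩
    rcases h.isExposed_iff.1 F.2 with hF | ⟨σ, hσ, hF⟩
    · exact ⟨Classical.arbitrary I, by change F.1 ⊆ _; rw [hF]; exact Set.empty_subset _⟩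
    · rcases σ.eq_empty_or_nonempty with rfl | ⟨f, hf⟩
      · rw [h0] at hF
        exact absurd ((isTop_iff F).2 hF t) (not_le_of_gt hFt)
      · refine ⟨f, ?_⟩
        change F.1 ⊆ _
        rw [hF]
        exact (h.face_subset_face_iff hσ).2 (by simpa using hf)
  · rintro ⟨f, rfl⟩
    refine ⟨⟨polyhedronFace ℓ a ∅, isExposed_face _⟩, (isTop_iff _).2 h0,
      hlt f _ ((isTop_iff _).2 h0), fun F hF hFt => ?_⟩
    rcases h.isExposed_iff.1 F.2 with hF' | ⟨σ, hσ, hF'⟩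
    · obtain ⟨y, hy⟩ := h.face_nonempty_iff.2 (isClique_singleton G f)
      have := hF.le hy
      rw [hF'] at this
      exact this
    · have h1 : polyhedronFace ℓ a {f} ⊆ polyhedronFace ℓ a σ := hF' ▸ hF.le
      have h2 := (h.face_subset_face_iff (isClique_singleton G f)).1 h1
      rcases Finset.subset_singleton_iff.1 h2 with rfl | rfl
      · exact hFt.ne (Subtype.ext hF')
      · exact hF.ne' (Subtype.ext hF')

/-- Two facets are adjacent if some non-empty face lies below both; this is a condition on the
face lattice alone. -/
theorem adj_iff (h : IsSimplePolyhedron ℓ a G) {f g : I} (hfg : f ≠ g) :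
    G.Adj f g ↔ ∃ F : FaceLattice (polyhedron ℓ a),
      ¬ IsBot F ∧ F ≤ facetOf ℓ a f ∧ F ≤ facetOf ℓ a g := by
  classical
  constructor
  · intro hadj
    have hcl : G.IsClique (({f, g} : Finset I) : Set I) := by
      simp [hadj]
    refine ⟨⟨polyhedronFace ℓ a {f, g}, isExposed_face _⟩, fun hb => ?_,
      (h.face_subset_face_iff hcl).2 (by simp), (h.face_subset_face_iff hcl).2 (by simp)⟩
    obtain ⟨y, hy⟩ := h.face_nonempty_iff.2 hcl
    exact hb ⟨∅, h.isExposed_iff.2 (Or.inl rfl)⟩ hy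
  · rintro ⟨F, hF, hf, hg⟩
    have hne : F.1.Nonempty := by
      rw [Set.nonempty_iff_ne_empty]
      intro h0
      exact hF fun F' => by change F.1 ⊆ _; rw [h0]; exact Set.empty_subset _
    obtain ⟨y, hy⟩ := hne
    exact h.adj_of_tight y (hf hy).1 f g hfg ((hf hy).2 f (by simp)) ((hg hy).2 g (by simp))

/-- An isomorphism of face lattices induces one of the dual graphs. -/
theorem exists_graphIso [Nonempty I] (h : IsSimplePolyhedron ℓ a G)
    (h' : IsSimplePolyhedron ℓ' a' G')
    (e : FaceLattice (polyhedron ℓ a) ≃o FaceLattice (polyhedron ℓ' a')) :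
    ∃ p : G ≃g G', ∀ f, e (facetOf ℓ a f) = facetOf ℓ' a' (p f) := by
  have key : ∀ F, (∃ f, F = facetOf ℓ a f) ↔ ∃ f, e F = facetOf ℓ' a' f := by
    intro F
    rw [← h.covBy_top_iff, ← h'.covBy_top_iff]
    constructor
    · rintro ⟨t, ht, hF⟩
      exact ⟨e t, fun x => by rw [← e.symm_apply_le]; exact ht _,
        (apply_covBy_apply_iff e).2 hF⟩
    · rintro ⟨t, ht, hF⟩
      refine ⟨e.symm t, fun x => by rw [e.le_symm_apply]; exact ht _, ?_⟩
      rw [← apply_covBy_apply_iff e, e.apply_symm_apply]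
      exact hF
  choose p hp using fun f => (key _).1 ⟨f, rfl⟩
  have hbij : Function.Bijective p := by
    constructor
    · intro f g hfg
      apply h.facetOf_injective
      apply e.injective
      rw [hp, hp, hfg]
    · intro g
      obtain ⟨f, hf⟩ := (key (e.symm (facetOf ℓ' a' g))).2 ⟨g, by simp⟩
      refine ⟨f, h'.facetOf_injective ?_⟩
      rw [← hp, ← hf, e.apply_symm_apply]
  refine ⟨⟨Equiv.ofBijective p hbij, ?_⟩, hp⟩
  intro f g
  simp only [Equiv.ofBijective_apply]
  by_cases hfg : f = g
  · subst hfg; simp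
  · rw [h.adj_iff hfg, h'.adj_iff (hbij.1.ne hfg), ← hp, ← hp]
    constructor
    · rintro ⟨F, hF, h1, h2⟩
      refine ⟨e.symm F, fun hb => hF fun x => ?_, e.symm_apply_le.2 h1, e.symm_apply_le.2 h2⟩
      rw [← e.symm.le_iff_le]; exact hb _
    · rintro ⟨F, hF, h1, h2⟩
      refine ⟨e F, fun hb => hF fun x => ?_, e.le_iff_le.2 h1, e.le_iff_le.2 h2⟩
      rw [← e.le_iff_le]; exact hb _

theorem isFaceOfDim_iff (h : IsSimplePolyhedron ℓ a G) (d : ℕ) (F : Set (Fin 3 → ℝ)) :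
    IsFaceOfDim (polyhedron ℓ a) d F ↔
      ∃ σ : Finset I, G.IsClique (σ : Set I) ∧ d + σ.card = 3 ∧ F = polyhedronFace ℓ a σ := by
  constructor
  · rintro ⟨hF, hne, hd⟩
    rcases h.isExposed_iff.1 hF with rfl | ⟨σ, hσ, rfl⟩
    · exact (Set.not_nonempty_empty hne).elim
    · have := h.finrank_vectorSpan_face hσ
      rw [hd, Module.finrank_fin_fun] at this
      exact ⟨σ, hσ, this, rfl⟩
  · rintro ⟨σ, hσ, hd, rfl⟩
    have := h.finrank_vectorSpan_face hσ
    rw [Module.finrank_fin_fun] at this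
    exact ⟨isExposed_face σ, h.face_nonempty_iff.2 hσ, by omega⟩

theorem fVector_eq (h : IsSimplePolyhedron ℓ a G) (d : Fin 3) :
    fVector (polyhedron ℓ a) d = {σ : Finset I | G.IsNClique (3 - d) σ}.ncard := by
  symm
  refine Set.ncard_congr (fun σ _ => polyhedronFace ℓ a σ) ?_ ?_ ?_
  · intro σ hσ
    exact (h.isFaceOfDim_iff _ _).2 ⟨σ, hσ.1, by have := hσ.2; omega, rfl⟩
  · intro σ τ hσ hτ he
    exact ((h.face_subset_face_iff hτ.1).1 he.ge).antisymm ((h.face_subset_face_iff hσ.1).1 he.le)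
  · intro F hF
    obtain ⟨σ, hσ, hd, rfl⟩ := (h.isFaceOfDim_iff _ _).1 hF
    exact ⟨σ, ⟨hσ, by omega⟩, rfl⟩

variable (h : IsSimplePolyhedron ℓ a G) {deg : I → ℕ}
  (hdeg : ∀ f, {τ : Finset I | G.IsNClique 3 τ ∧ f ∈ τ}.ncard = deg f)
include h hdeg

theorem ncard_extremePoints_facet (f : I) :
    (Set.extremePoints ℝ (polyhedronFace ℓ a {f})).ncard = deg f := by
  rw [h.ncard_extremePoints_face, Module.finrank_fin_fun, ← hdeg]
  simp

theorem isPolygonFacet_iff (m : ℕ) (F : Set (Fin 3 → ℝ)) :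
    IsPolygonFacet (polyhedron ℓ a) m F ↔ ∃ f, F = polyhedronFace ℓ a {f} ∧ deg f = m := by
  rw [IsPolygonFacet, h.isFaceOfDim_iff]
  constructor
  · rintro ⟨⟨σ, hσ, hd, rfl⟩, hm⟩
    obtain ⟨f, rfl⟩ := Finset.card_eq_one.1 (show σ.card = 1 by omega)
    exact ⟨f, rfl, by rw [← hm, h.ncard_extremePoints_facet hdeg]⟩
  · rintro ⟨f, rfl, rfl⟩
    exact ⟨⟨{f}, isClique_singleton G f, by simp, rfl⟩, h.ncard_extremePoints_facet hdeg f⟩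

theorem polygonVector_eq (m : Fin 4) :
    polygonVector (polyhedron ℓ a) m = {f | deg f = m + 3}.ncard := by
  symm
  refine Set.ncard_congr (fun f _ => polyhedronFace ℓ a {f}) ?_ ?_ ?_
  · intro f hf
    exact (h.isPolygonFacet_iff hdeg _ _).2 ⟨f, rfl, hf⟩
  · intro f g _ _ he
    exact h.facetOf_injective (Subtype.ext he)
  · intro F hF
    obtain ⟨f, rfl, hf⟩ := (h.isPolygonFacet_iff hdeg _ _).1 hF
    exact ⟨f, hf, rfl⟩

/-- Two hexagons share an edge precisely when their labels are adjacent in the dual graph. -/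
theorem nonempty_hexagonGraph_iso :
    Nonempty (hexagonGraph (polyhedron ℓ a) ≃g G.induce {f | deg f = 6}) := by
  classical
  have hbij : Function.Bijective (fun f : {f // f ∈ {f | deg f = 6}} =>
      (⟨polyhedronFace ℓ a {f.1}, (h.isPolygonFacet_iff hdeg _ _).2 ⟨f.1, rfl, f.2⟩⟩ :
        {F // IsPolygonFacet (polyhedron ℓ a) 6 F})) := by
    constructor
    · intro f g hfg
      exact Subtype.ext (h.face_singleton_injective (Subtype.ext_iff.1 hfg))
    · rintro ⟨F, hF⟩
      obtain ⟨f, rfl, hf⟩ := (h.isPolygonFacet_iff hdeg _ _).1 hF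
      exact ⟨⟨f, hf⟩, rfl⟩
  refine ⟨(RelIso.mk (Equiv.ofBijective _ hbij) ?_ : G.induce {f | deg f = 6} ≃g _).symm⟩
  rintro ⟨f, hf⟩ ⟨g, hg⟩
  simp only [hexagonGraph, Equiv.ofBijective_apply, SimpleGraph.comap_adj,
    Function.Embedding.subtype_apply, ne_eq]
  have hint : polyhedronFace ℓ a {f} ∩ polyhedronFace ℓ a {g} = polyhedronFace ℓ a {f, g} := by
    ext y
    simp only [polyhedronFace, Set.mem_inter_iff, Set.mem_ofPred_eq, Finset.mem_singleton,
      forall_eq, Finset.mem_insert, forall_eq_or_imp]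
    tauto
  rw [hint]
  have hcl : ∀ σ : Finset I, (polyhedronFace ℓ a σ).Nonempty ↔ _ := fun σ => h.face_nonempty_iff
  constructor
  · rintro ⟨hne, hF⟩
    have h1 := (hcl _).1 hF.2.1
    have hfg : f ≠ g := fun he => hne (by subst he; rfl)
    exact h1 (by simp) (by simp) hfg
  · intro hadj
    refine ⟨fun he => hadj.ne (h.face_singleton_injective (Subtype.ext_iff.1 he)),
      (h.isFaceOfDim_iff _ _).2 ⟨{f, g}, ?_, by simp [Finset.card_pair hadj.ne], rfl⟩⟩
    simp [hadj]

end IsSimplePolyhedron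
end FaceLattice

/-! ### Kleene stars and their spans -/

theorem homog_castSucc (y : Fin 3 → ℝ) (i : Fin 3) : homog y i.castSucc = y i := by
  simp [homog]

theorem homog_three (y : Fin 3 → ℝ) : homog y 3 = 0 := by
  simp [homog, Fin.snoc]

theorem dehom_homog (y : Fin 3 → ℝ) : dehom (homog y) = y := by
  ext i; simp [dehom, homog_castSucc, homog_three]

theorem homog_dehom (x : Fin 4 → ℝ) (i : Fin 4) : homog (dehom x) i = x i - x 3 := by
  induction i using Fin.lastCases with
  | last => simp [homog, Fin.snoc]
  | cast i => simp [dehom, homog_castSucc]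

theorem dehom_congr {x x' : Fin 4 → ℝ} (c : ℝ) (h : ∀ m, x m = x' m + c) :
    dehom x = dehom x' := by
  ext i
  rw [dehom, dehom, h, h]; ring

/-- The functional `X_i - X_j` (where `X₄ = 0`). -/
noncomputable def rootForm (f : Root) : StrongDual ℝ (Fin 3 → ℝ) :=
  LinearMap.toContinuousLinearMap
    { toFun := fun y => homog y f.1.1 - homog y f.1.2
      map_add' := by
        have h : ∀ (y z : Fin 3 → ℝ) i, homog (y + z) i = homog y i + homog z i := by
          intro y z i
          induction i using Fin.lastCases <;> simp [homog, Fin.snoc]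
        intro y z; rw [h, h]; ring
      map_smul' := by
        have h : ∀ (c : ℝ) (y : Fin 3 → ℝ) i, homog (c • y) i = c * homog y i := by
          intro y z i
          induction i using Fin.lastCases <;> simp [homog, Fin.snoc]
        intro y z; rw [h, h, RingHom.id_apply, smul_eq_mul]; ring }

theorem rootForm_apply (f : Root) (y : Fin 3 → ℝ) :
    rootForm f y = homog y f.1.1 - homog y f.1.2 := rfl

theorem rootForm_dehom (f : Root) (x : Fin 4 → ℝ) :
    rootForm f (dehom x) = x f.1.1 - x f.1.2 := by
  rw [rootForm_apply, homog_dehom, homog_dehom]; ring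

/-- The entries of `A` off the diagonal. -/
def offDiag (A : Matrix (Fin 4) (Fin 4) ℝ) (f : Root) : ℝ := A f.1.1 f.1.2

theorem IsKleeneStar.triangle {A : Matrix (Fin 4) (Fin 4) ℝ} (h : IsKleeneStar A) (i j k : Fin 4) :
    A i j + A j k ≤ A i k := by
  conv_rhs => rw [← h.idem]
  exact Finset.le_sup' (fun m => A i m + A m k) (Finset.mem_univ j)

theorem isKleeneStar_of_triangle {A : Matrix (Fin 4) (Fin 4) ℝ} (h0 : ∀ i, A i i = 0)
    (h : ∀ i j k, A i j + A j k ≤ A i k) : IsKleeneStar A := by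
  refine ⟨h0, ?_⟩
  ext i k
  change Finset.univ.sup' Finset.univ_nonempty (fun j => A i j + A j k) = A i k
  refine le_antisymm (Finset.sup'_le _ _ fun j _ => h i j k) ?_
  exact Finset.le_sup'_of_le _ (Finset.mem_univ k) (by simp [h0])

/-- The span of a Kleene star consists of the points `X` with `X_i - X_j ≥ a_ij`. -/
theorem IsKleeneStar.tropSpan_eq {A : Matrix (Fin 4) (Fin 4) ℝ} (h : IsKleeneStar A) :
    tropSpan A = polyhedron rootForm (offDiag A) := by
  ext y
  constructor
  · rintro ⟨c, rfl⟩ f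
    rw [rootForm_dehom, le_sub_iff_add_le, offDiag]
    obtain ⟨j, -, hj⟩ := Finset.exists_mem_eq_sup' Finset.univ_nonempty fun j => c j + A f.1.2 j
    rw [hj]
    exact Finset.le_sup'_of_le _ (Finset.mem_univ j) (by linarith [h.triangle f.1.1 f.1.2 j])
  · intro hy
    refine ⟨homog y, ?_⟩
    conv_lhs => rw [← dehom_homog y]
    congr 1
    ext i
    refine le_antisymm ?_ (Finset.sup'_le _ _ fun j _ => ?_)
    · exact Finset.le_sup'_of_le _ (Finset.mem_univ i) (by simp [h.diag])
    · by_cases hij : i = j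
      · subst hij; simp [h.diag]
      · have := hy ⟨(i, j), hij⟩
        rw [rootForm_apply, offDiag] at this
        dsimp only at this
        linarith

theorem perm_fin_two : ∀ s : Equiv.Perm (Fin 2), s = 1 ∨ s = Equiv.swap 0 1 := by decide

theorem tropDet_fin_two (M : Matrix (Fin 2) (Fin 2) ℝ) :
    tropDet M = max (M 0 0 + M 1 1) (M 0 1 + M 1 0) := by
  refine le_antisymm (Finset.sup'_le _ _ fun s _ => ?_) (max_le ?_ ?_)
  · rcases perm_fin_two s with rfl | rfl <;> simp [Fin.sum_univ_two]
  · exact Finset.le_sup'_of_le _ (Finset.mem_univ 1) (by simp [Fin.sum_univ_two])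
  · exact Finset.le_sup'_of_le _ (Finset.mem_univ (Equiv.swap 0 1)) (by simp [Fin.sum_univ_two])

theorem tropRegular_fin_two (M : Matrix (Fin 2) (Fin 2) ℝ) :
    TropRegular M ↔ M 0 0 + M 1 1 ≠ M 0 1 + M 1 0 := by
  constructor
  · rintro ⟨s, hs⟩
    rcases perm_fin_two s with rfl | rfl
    · have := hs (Equiv.swap 0 1) (by decide)
      simp [Fin.sum_univ_two] at this
      exact this.ne'
    · have := hs 1 (by decide)
      simp [Fin.sum_univ_two] at this
      exact this.ne
  · intro h
    rcases lt_or_gt_of_ne h with h | h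
    · refine ⟨Equiv.swap 0 1, fun t ht => ?_⟩
      rcases perm_fin_two t with rfl | rfl
      · simpa [Fin.sum_univ_two] using h
      · exact (ht rfl).elim
    · refine ⟨1, fun t ht => ?_⟩
      rcases perm_fin_two t with rfl | rfl
      · exact (ht rfl).elim
      · simpa [Fin.sum_univ_two] using h

/-- The inequalities equivalent to admissibility (`Admissible.isGenericStar`,
`IsGenericStar.admissible`). In `triangle` the case `i = k` is included. -/
structure IsGenericStar (A : Matrix (Fin 4) (Fin 4) ℝ) : Prop where
  diag : ∀ i, A i i = 0
  triangle : ∀ i j k, i ≠ j → j ≠ k → A i j + A j k < A i k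
  square : ∀ k i l j, k ≠ l → i ≠ j → k ≠ i → k ≠ j → l ≠ i → l ≠ j →
    A k i + A l j ≠ A k j + A l i

theorem exists_third : ∀ i j : Fin 4, ∃ k, k ≠ i ∧ k ≠ j := by decide

theorem exists_compl : ∀ i j : Fin 4, i ≠ j → ∃ k l, k ≠ i ∧ k ≠ j ∧ l ≠ i ∧ l ≠ j ∧ k ≠ l := by
  decide

theorem mem_four : ∀ k i l j : Fin 4, k ≠ l → i ≠ j → k ≠ i → k ≠ j → l ≠ i → l ≠ j →
    ∀ m, m = k ∨ m = i ∨ m = l ∨ m = j := by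
  intro k i l j; omega

theorem IsGenericStar.isKleeneStar {A : Matrix (Fin 4) (Fin 4) ℝ} (h : IsGenericStar A) :
    IsKleeneStar A := by
  refine isKleeneStar_of_triangle h.diag fun i j k => ?_
  by_cases hij : i = j
  · subst hij; simp [h.diag]
  by_cases hjk : j = k
  · subst hjk; simp [h.diag]
  exact (h.triangle i j k hij hjk).le

set_option synthInstance.maxHeartbeats 200000 in
set_option synthInstance.maxSize 1000 in
theorem card_three_cases : ∀ k l i j : Fin 4, k ≠ l → i ≠ j →
    3 ≤ ({k, l, i, j} : Finset (Fin 4)).card →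
    (k = i ∧ l ≠ j ∧ k ≠ j ∧ l ≠ i) ∨ (k = j ∧ l ≠ i ∧ k ≠ i ∧ l ≠ j) ∨
    (l = i ∧ k ≠ j ∧ k ≠ i ∧ l ≠ j) ∨ (l = j ∧ k ≠ i ∧ k ≠ j ∧ l ≠ i) ∨
    (k ≠ i ∧ k ≠ j ∧ l ≠ i ∧ l ≠ j) := by decide

theorem card_three : ∀ i j k : Fin 4, i ≠ j → j ≠ k → i ≠ k →
    3 ≤ ({i, j, j, k} : Finset (Fin 4)).card := by decide

theorem card_four : ∀ k i l j : Fin 4, k ≠ l → i ≠ j → k ≠ i → k ≠ j → l ≠ i → l ≠ j →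
    3 ≤ ({k, l, i, j} : Finset (Fin 4)).card := by
  intro k i l j h1 h2 h3 h4 h5 h6
  rw [Finset.card_insert_of_notMem, Finset.card_insert_of_notMem, Finset.card_pair h2] <;>
  simp [*]

/-- Strictness of the triangle inequalities is the regularity of the minors with three indices. -/
theorem Admissible.isGenericStar {A : Matrix (Fin 4) (Fin 4) ℝ} (h : Admissible A) :
    IsGenericStar A := by
  have h0 := h.kleene.diag
  have hm : ∀ k l i j : Fin 4, k ≠ l → i ≠ j → 3 ≤ ({k, l, i, j} : Finset (Fin 4)).card →
      A k i + A l j ≠ A k j + A l i := fun k l i j h1 h2 h3 => by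
    simpa using (tropRegular_fin_two _).1 (h.hyp2 k l i j h1 h2 h3)
  have h3 : ∀ i j k, i ≠ j → j ≠ k → i ≠ k → A i j + A j k < A i k := by
    intro i j k hij hjk hik
    have := hm i j j k hij hjk (card_three i j k hij hjk hik)
    rw [h0 j, add_zero] at this
    exact lt_of_le_of_ne (h.kleene.triangle i j k) this
  refine ⟨h0, fun i j k hij hjk => ?_, fun k i l j h1 h2 h4 h5 h6 h7 =>
    hm k l i j h1 h2 (card_four k i l j h1 h2 h4 h5 h6 h7)⟩
  by_cases hik : i = k
  · subst hik
    obtain ⟨m, hmi, hmj⟩ := exists_third i j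
    linarith [h3 i j m hij hmj.symm hmi.symm, h3 j i m hjk hmi.symm hmj.symm, h0 i]
  · exact h3 i j k hij hjk hik

theorem IsGenericStar.admissible {A : Matrix (Fin 4) (Fin 4) ℝ} (h : IsGenericStar A) :
    Admissible A := by
  refine ⟨h.isKleeneStar, ?_, ?_⟩
  · rintro ⟨a, ha⟩
    -- In column `j` the maximum is attained off the diagonal, say in row `r j`; the rows `r 0`
    -- and `r (r 0)` contradict a strict triangle inequality.
    have key : ∀ j, ∃ i, i ≠ j ∧ ∀ k, a k + A k j ≤ a i + A i j := by
      intro j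
      obtain ⟨p, q, hpq, he, hmax⟩ := ha j
      simp only [Matrix.col_apply] at he hmax
      by_cases hp : p = j
      · exact ⟨q, fun hq => hpq (hp.trans hq.symm), fun k => (hmax k).trans he.le⟩
      · exact ⟨p, hp, hmax⟩
    choose r hr hmax using key
    have h1 := hmax (r 0) (r 0)
    rw [h.diag] at h1
    linarith [hmax 0 (r (r 0)), h.triangle (r (r 0)) (r 0) 0 (hr _) (hr _)]
  · intro k l i j hkl hij hc
    rw [tropRegular_fin_two]
    simp only [Matrix.submatrix_apply, Matrix.cons_val_zero, Matrix.cons_val_one]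
    rcases card_three_cases k l i j hkl hij hc with
      ⟨rfl, h1, h2, h3⟩ | ⟨rfl, h1, h2, h3⟩ | ⟨rfl, h1, h2, h3⟩ | ⟨rfl, h1, h2, h3⟩ |
        ⟨h1, h2, h3, h4⟩
    · have := h.triangle l k j hkl.symm h2; rw [h.diag k]; intro h'; linarith
    · have := (h.triangle l k i hkl.symm h2); rw [h.diag k]; intro h'; linarith
    · have := (h.triangle k l j h2 h3); rw [h.diag l]; intro h'; linarith
    · have := (h.triangle k l i hkl h3); rw [h.diag l]; intro h'; linarith
    · exact h.square k i l j hkl hij h1 h2 h3 h4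

/-! ### The pattern of a generic Kleene star -/

open Classical in
/-- The types of the six lines `L_ij` of `A`. -/
noncomputable def patternOf (A : Matrix (Fin 4) (Fin 4) ℝ) : Pattern where
  u r := decide (A (r + 1).castSucc r.castSucc + A (r + 2).castSucc 3 <
    A (r + 1).castSucc 3 + A (r + 2).castSucc r.castSucc)
  w r := decide (A 3 (r + 2).castSucc + A r.castSucc (r + 1).castSucc <
    A 3 (r + 1).castSucc + A r.castSucc (r + 2).castSucc)

namespace IsGenericStar

variable {A : Matrix (Fin 4) (Fin 4) ℝ}

/-- The six comparisons cannot all have the same outcome, since the six differences compared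
add up to zero. -/
theorem isGood_patternOf (h : IsGenericStar A) : (patternOf A).IsGood := by
  have c0 : (0 : Fin 3).castSucc = 0 := rfl
  have c1 : (1 : Fin 3).castSucc = 1 := rfl
  have c2 : (2 : Fin 3).castSucc = 2 := rfl
  have a1 : (1 + 1 : Fin 3) = 2 := rfl
  have a2 : (1 + 2 : Fin 3) = 0 := rfl
  have a3 : (2 + 1 : Fin 3) = 0 := rfl
  have a4 : (2 + 2 : Fin 3) = 1 := rfl
  simp only [Pattern.IsGood, patternOf, decide_eq_true_iff, decide_eq_false_iff_not]
  constructor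
  · by_contra! hc
    have h0 := hc 0
    have h1 := hc 1
    have h2 := hc 2
    simp only [zero_add, c0, c1, c2, a1, a2, a3, a4] at h0 h1 h2
    -- `hc` bounds all six differences by zero from above and their sum is zero.
    exact h.square 1 0 2 3 (by decide) (by decide) (by decide) (by decide) (by decide) (by decide)
      (by linarith)
  · by_contra! hc
    have h0 := hc 0
    have h1 := hc 1
    have h2 := hc 2
    simp only [zero_add, c0, c1, c2, a1, a2, a3, a4] at h0 h1 h2
    linarith

theorem lineType_eq_iff (h : IsGenericStar A) : ∀ k i l j, k ≠ l → i ≠ j → k ≠ i → k ≠ j →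
    l ≠ i → l ≠ j →
    ((patternOf A).lineType i j = pairing k i ↔ A k j + A l i < A k i + A l j) := by
  have c0 : (0 : Fin 3).castSucc = 0 := rfl
  have c1 : (1 : Fin 3).castSucc = 1 := rfl
  have c2 : (2 : Fin 3).castSucc = 2 := rfl
  have a1 : (1 + 1 : Fin 3) = 2 := rfl
  have a2 : (1 + 2 : Fin 3) = 0 := rfl
  have a3 : (2 + 1 : Fin 3) = 0 := rfl
  have a4 : (2 + 2 : Fin 3) = 1 := rfl
  intro k i l j h1 h2 h3 h4 h5 h6
  have hs := h.square k i l j h1 h2 h3 h4 h5 h6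
  fin_cases k <;> fin_cases i <;> first | exact (h3 rfl).elim | skip
  all_goals fin_cases l <;> first | exact (h1 rfl).elim | exact (h5 rfl).elim | skip
  all_goals
    fin_cases j <;> first | exact (h2 rfl).elim | exact (h4 rfl).elim | exact (h6 rfl).elim | skip
  all_goals
    simp [Pattern.lineType, pairing, patternOf, a1, a2, a3, a4] at hs ⊢
    try (constructor <;> intro h' <;> first
      | linarith
      | exact lt_of_le_of_ne (by linarith) fun h'' => hs (by linarith))

/-- Two inequalities tight at a common point label adjacent facets. -/
theorem adj_of_tight (h : IsGenericStar A) {y : Fin 3 → ℝ}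
    (hy : y ∈ polyhedron rootForm (offDiag A)) (f g : Root) (hfg : f ≠ g)
    (hf : rootForm f y = offDiag A f) (hg : rootForm g y = offDiag A g) :
    (patternOf A).graph.Adj f g := by
  obtain ⟨⟨k, i⟩, hki⟩ := f
  obtain ⟨⟨l, j⟩, hlj⟩ := g
  have hle : ∀ p q, A p q ≤ homog y p - homog y q := by
    intro p q
    by_cases hpq : p = q
    · subst hpq; simp [h.diag]
    · exact hy ⟨(p, q), hpq⟩
  simp only [rootForm_apply, offDiag] at hf hg
  dsimp only at hki hlj
  have hkj : k ≠ j := by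
    rintro rfl
    linarith [hle l i, h.triangle l k i hlj hki]
  have hli : l ≠ i := by
    rintro rfl
    linarith [hle k j, h.triangle k l j hki hlj]
  refine ⟨hfg, hkj, hli, fun hkl hij => ?_⟩
  dsimp only at hkl hij ⊢
  rw [h.lineType_eq_iff k i l j hkl hij hki hkj hli hlj]
  exact lt_of_le_of_ne (by linarith [hle k j, hle l i])
    (h.square k i l j hkl hij hki hkj hli hlj).symm

end IsGenericStar

/-- A clique of the dual graph lies in one of the triangles of the triangulated cuboctahedron: the
pairs with a given first index, those with a given second index, or one half of a square. -/
theorem Pattern.clique_cases (s : Pattern) {σ : Finset Root}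
    (hσ : s.graph.IsClique (σ : Set Root)) :
    (∃ k, ∀ f ∈ σ, f.1.1 = k) ∨ (∃ i, ∀ f ∈ σ, f.1.2 = i) ∨
    ∃ k i l j, (k ≠ l ∧ i ≠ j ∧ k ≠ i ∧ k ≠ j ∧ l ≠ i ∧ l ≠ j) ∧ s.lineType i j = pairing k i ∧
      ∀ f ∈ σ, f.1 = (k, i) ∨ f.1 = (k, j) ∨ f.1 = (l, j) := by
  by_cases h1 : ∃ k, ∀ f ∈ σ, f.1.1 = k
  · exact Or.inl h1
  by_cases h2 : ∃ i, ∀ f ∈ σ, f.1.2 = i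
  · exact Or.inr (Or.inl h2)
  refine Or.inr (Or.inr ?_)
  push Not at h1 h2
  -- Two elements of `σ` that differ in both indices.
  obtain ⟨f, hf, g, hg, hfg1, hfg2⟩ : ∃ f ∈ σ, ∃ g ∈ σ, f.1.1 ≠ g.1.1 ∧ f.1.2 ≠ g.1.2 := by
    obtain ⟨f, hf, -⟩ := h1 0
    obtain ⟨g, hg, hgf⟩ := h1 f.1.1
    by_cases hc : f.1.2 = g.1.2
    · obtain ⟨e, he, hef⟩ := h2 f.1.2
      by_cases hc' : e.1.1 = f.1.1
      · exact ⟨e, he, g, hg, fun hh => hgf (hh.symm.trans hc'), fun hh => hef (hh.trans hc.symm)⟩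
      · exact ⟨e, he, f, hf, hc', hef⟩
    · exact ⟨f, hf, g, hg, fun hh => hgf hh.symm, hc⟩
  have hadj : ∀ {f g : Root}, f ∈ σ → g ∈ σ → f.1.1 ≠ g.1.2 ∧
      (f.1.1 ≠ g.1.1 → f.1.2 ≠ g.1.2 → s.lineType f.1.2 g.1.2 = pairing f.1.1 f.1.2) := by
    intro f g hf hg
    by_cases hc : f = g
    · subst hc; exact ⟨f.2, fun hh => absurd rfl hh⟩
    · exact ⟨(hσ hf hg hc).2.1, (hσ hf hg hc).2.2.2⟩
  obtain ⟨⟨k, i⟩, hki⟩ := f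
  obtain ⟨⟨l, j⟩, hlj⟩ := g
  dsimp only at hfg1 hfg2 hki hlj
  have hkj : k ≠ j := (hadj hf hg).1
  have hli : l ≠ i := (hadj hg hf).1
  have ht : s.lineType i j = pairing k i := (hadj hf hg).2 hfg1 hfg2
  have hmem : ∀ e ∈ σ, (e.1.1 = k ∨ e.1.1 = l) ∧ (e.1.2 = i ∨ e.1.2 = j) := by
    intro e he
    have e1 := (hadj he hf).1
    have e2 := (hadj he hg).1
    have e3 := (hadj hf he).1
    have e4 := (hadj hg he).1
    dsimp only at e1 e2 e3 e4
    have m1 := mem_four k i l j hfg1 hfg2 hki hkj hli hlj e.1.1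
    have m2 := mem_four k i l j hfg1 hfg2 hki hkj hli hlj e.1.2
    have := e.2
    grind
  -- The rest of `σ` lies in the same square and does not contain both ends of the other diagonal.
  by_cases hk : ∃ e ∈ σ, e.1 = (l, i)
  · refine ⟨l, j, k, i, ⟨hfg1.symm, hfg2.symm, hlj, hli, hkj, hki⟩, ?_, fun e he => ?_⟩
    · rw [lineType_comm, ht, pairing_compl k i l j hki hfg1 hkj hli.symm hfg2 hlj]
    · obtain ⟨e', he', hee⟩ := hk
      have h3 := (hadj he he').2
      have h4 := pairing_ne k i j hki hkj hfg2
      have h5 := hmem e he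
      rw [hee] at h3
      obtain ⟨⟨e1, e2⟩, he3⟩ := e
      dsimp only at h3 h5 ⊢
      have h6 : ¬ (e1 = k ∧ e2 = j) := by
        rintro ⟨rfl, rfl⟩
        have := h3 hfg1 hfg2.symm
        rw [lineType_comm, ht] at this
        exact h4 this
      simp only [Prod.mk.injEq]
      tauto
  · refine ⟨k, i, l, j, ⟨hfg1, hfg2, hki, hkj, hli, hlj⟩, ht, fun e he => ?_⟩
    have h5 := hmem e he
    have h6 : e.1 ≠ (l, i) := fun hh => hk ⟨e, he, hh⟩
    obtain ⟨⟨e1, e2⟩, he3⟩ := e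
    simp only [Prod.mk.injEq, ne_eq] at h5 h6 ⊢
    tauto

/-! ### The vertices of the span -/

/-- The triangle of the pairs with first index `k`. -/
def starSet (k : Fin 4) : Finset Root := Finset.univ.filter fun f => f.1.1 = k

/-- The triangle of the pairs with second index `i`. -/
def costarSet (i : Fin 4) : Finset Root := Finset.univ.filter fun f => f.1.2 = i

/-- One half of the square `{k, l} × {i, j}` cut along the diagonal from `(k, i)` to `(l, j)`. -/
def halfSet (k i l j : Fin 4) : Finset Root :=
  Finset.univ.filter fun f => f.1 = (k, i) ∨ f.1 = (k, j) ∨ f.1 = (l, j)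

/-- The point at which the inequalities in `halfSet k i l j` are tight. -/
def halfPoint (A : Matrix (Fin 4) (Fin 4) ℝ) (k i l j : Fin 4) : Fin 4 → ℝ := fun m =>
  if m = k then 0 else if m = i then -A k i else if m = j then -A k j else A l j - A k j

/-- `x` represents a vertex of the span, at which exactly the inequalities in `τ` are tight. -/
structure IsVertexAt (A : Matrix (Fin 4) (Fin 4) ℝ) (x : Fin 4 → ℝ) (τ : Finset Root) : Prop where
  tight : ∀ f ∈ τ, x f.1.1 - x f.1.2 = offDiag A f
  slack : ∀ f ∉ τ, offDiag A f < x f.1.1 - x f.1.2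
  existsUnique : ∀ b : Root → ℝ, ∃! y : Fin 3 → ℝ, ∀ f ∈ τ, rootForm f y = b f

/-- The criterion for the functionals `X_i - X_j` indexed by `τ` to form a basis: `τ` is a spanning
tree of the four indices, with `x b` the potential having the differences `b`. -/
theorem existsUnique_rootForm {τ : Finset Root} (x : (Root → ℝ) → Fin 4 → ℝ)
    (h1 : ∀ b, ∀ f ∈ τ, x b f.1.1 - x b f.1.2 = b f)
    (h2 : ∀ z : Fin 4 → ℝ, (∀ f ∈ τ, z f.1.1 = z f.1.2) → ∀ p, z p = z 3) (b : Root → ℝ) :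
    ∃! y : Fin 3 → ℝ, ∀ f ∈ τ, rootForm f y = b f := by
  refine ⟨dehom (x b), fun f hf => by rw [rootForm_dehom, h1 b f hf], fun y hy => ?_⟩
  have h3 := h2 (fun p => homog y p - x b p) fun f hf => by
    have h4 := hy f hf
    rw [rootForm_apply] at h4
    linarith [h1 b f hf]
  rw [← dehom_homog y]
  refine dehom_congr (homog y 3 - x b 3) fun p => ?_
  linarith [h3 p]

/-- The pairs with a given first index form a spanning tree. -/
theorem existsUnique_star (k : Fin 4) (b : Root → ℝ) :
    ∃! y : Fin 3 → ℝ, ∀ f ∈ starSet k, rootForm f y = b f := by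
  refine existsUnique_rootForm
    (fun b m => if h : k ≠ m then - b ⟨(k, m), h⟩ else 0) ?_ ?_ b
  · rintro b ⟨⟨p, q⟩, hpq⟩ hf
    obtain rfl : p = k := by simpa [starSet] using hf
    dsimp only at hpq ⊢
    simp [hpq]
  · intro z hz
    have h1 : ∀ m, z k = z m := fun m => by
      by_cases hm : k = m
      · rw [hm]
      · exact hz ⟨(k, m), hm⟩ (by simp [starSet])
    exact fun p => (h1 p).symm.trans (h1 3)

theorem existsUnique_costar (i : Fin 4) (b : Root → ℝ) :
    ∃! y : Fin 3 → ℝ, ∀ f ∈ costarSet i, rootForm f y = b f := by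
  refine existsUnique_rootForm
    (fun b m => if h : m ≠ i then b ⟨(m, i), h⟩ else 0) ?_ ?_ b
  · rintro b ⟨⟨p, q⟩, hpq⟩ hf
    obtain rfl : q = i := by simpa [costarSet] using hf
    dsimp only at hpq ⊢
    simp [hpq]
  · intro z hz
    have h1 : ∀ m, z m = z i := fun m => by
      by_cases hm : m = i
      · rw [hm]
      · exact hz ⟨(m, i), hm⟩ (by simp [costarSet])
    exact fun p => (h1 p).trans (h1 3).symm

theorem existsUnique_half {k i l j : Fin 4}
    (hd : k ≠ l ∧ i ≠ j ∧ k ≠ i ∧ k ≠ j ∧ l ≠ i ∧ l ≠ j) (b : Root → ℝ) :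
    ∃! y : Fin 3 → ℝ, ∀ f ∈ halfSet k i l j, rootForm f y = b f := by
  obtain ⟨h1, h2, h3, h4, h5, h6⟩ := hd
  refine existsUnique_rootForm (fun b m => if m = k then 0 else if m = i then - b ⟨(k, i), h3⟩
    else if m = j then - b ⟨(k, j), h4⟩ else b ⟨(l, j), h6⟩ - b ⟨(k, j), h4⟩) ?_ ?_ b
  · rintro b ⟨f, hpq⟩ hf
    simp only [halfSet, Finset.mem_filter, Finset.mem_univ, true_and] at hf
    rcases hf with rfl | rfl | rfl
    · simp [h3.symm]
    · simp [h4.symm, h2.symm]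
    · simp [h4.symm, h2.symm, h1.symm, h5, h6]
  · intro z hz
    have e1 : z k = z i := hz ⟨(k, i), h3⟩ (by simp [halfSet])
    have e2 : z k = z j := hz ⟨(k, j), h4⟩ (by simp [halfSet])
    have e3 : z l = z j := hz ⟨(l, j), h6⟩ (by simp [halfSet])
    have hk : ∀ p, z p = z k := by
      intro p
      rcases mem_four k i l j h1 h2 h3 h4 h5 h6 p with rfl | rfl | rfl | rfl
      · rfl
      · exact e1.symm
      · exact e3.trans e2.symm
      · exact e2.symm
    exact fun p => (hk p).trans (hk 3).symm

namespace IsGenericStar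

variable {A : Matrix (Fin 4) (Fin 4) ℝ}

theorem isVertexAt_star (h : IsGenericStar A) (k : Fin 4) :
    IsVertexAt A (fun m => -A k m) (starSet k) := by
  refine ⟨?_, ?_, existsUnique_star k⟩
  · rintro ⟨⟨p, q⟩, hpq⟩ hf
    obtain rfl : p = k := by simpa [starSet] using hf
    simp [offDiag, h.diag]
  · rintro ⟨⟨p, q⟩, hpq⟩ hf
    have hp : k ≠ p := by simpa [starSet, eq_comm] using hf
    have := h.triangle k p q hp hpq
    dsimp only [offDiag]
    linarith

theorem isVertexAt_costar (h : IsGenericStar A) (i : Fin 4) :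
    IsVertexAt A (A.col i) (costarSet i) := by
  refine ⟨?_, ?_, existsUnique_costar i⟩
  · rintro ⟨⟨p, q⟩, hpq⟩ hf
    obtain rfl : q = i := by simpa [costarSet] using hf
    simp [offDiag, h.diag]
  · rintro ⟨⟨p, q⟩, hpq⟩ hf
    have hq : q ≠ i := by simpa [costarSet] using hf
    have := h.triangle p q i hpq hq
    simp only [offDiag, Matrix.col_apply]
    linarith

theorem isVertexAt_half (h : IsGenericStar A) {k i l j : Fin 4}
    (hd : k ≠ l ∧ i ≠ j ∧ k ≠ i ∧ k ≠ j ∧ l ≠ i ∧ l ≠ j)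
    (hlt : A k j + A l i < A k i + A l j) :
    IsVertexAt A (halfPoint A k i l j) (halfSet k i l j) := by
  have hu := existsUnique_half hd
  obtain ⟨h1, h2, h3, h4, h5, h6⟩ := hd
  have xk : halfPoint A k i l j k = 0 := by simp [halfPoint]
  have xi : halfPoint A k i l j i = -A k i := by simp [halfPoint, h3.symm]
  have xj : halfPoint A k i l j j = -A k j := by simp [halfPoint, h4.symm, h2.symm]
  have xl : halfPoint A k i l j l = A l j - A k j := by simp [halfPoint, h1.symm, h5, h6]
  refine ⟨?_, ?_, hu⟩
  · rintro ⟨f, hpq⟩ hf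
    simp only [halfSet, Finset.mem_filter, Finset.mem_univ, true_and] at hf
    rcases hf with rfl | rfl | rfl <;> simp only [xk, xi, xj, xl, offDiag] <;> ring
  · rintro ⟨⟨p, q⟩, hpq⟩ hf
    simp only [halfSet, Finset.mem_filter, Finset.mem_univ, true_and, Prod.mk.injEq] at hf
    have t1 := h.triangle k i j h3 h2
    have t2 := h.triangle k j i h4 h2.symm
    have t3 := h.triangle k l j h1 h6
    have t4 := h.triangle l k j h1.symm h4
    have t5 := h.triangle i k i h3.symm h3
    have t6 := h.triangle j k j h4.symm h4
    have t7 := h.triangle j l j h6.symm h6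
    have t8 := h.triangle i l j h5.symm h6
    have d1 := h.diag i
    have d2 := h.diag j
    dsimp only [offDiag] at hpq ⊢
    rcases mem_four k i l j h1 h2 h3 h4 h5 h6 p with rfl | rfl | rfl | rfl <;>
    rcases mem_four _ _ _ _ h1 h2 h3 h4 h5 h6 q with rfl | rfl | rfl | rfl <;>
    first
      | exact absurd rfl hpq
      | (refine absurd ?_ hf; simp; done)
      | (simp only [xk, xi, xj, xl]; linarith)

end IsGenericStar

theorem IsVertexAt.mem_polyhedron {A : Matrix (Fin 4) (Fin 4) ℝ} {x : Fin 4 → ℝ} {τ : Finset Root}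
    (h : IsVertexAt A x τ) : dehom x ∈ polyhedron rootForm (offDiag A) := by
  intro f
  rw [rootForm_dehom]
  by_cases hf : f ∈ τ
  · exact (h.tight f hf).ge
  · exact (h.slack f hf).le

theorem IsVertexAt.tight_iff {A : Matrix (Fin 4) (Fin 4) ℝ} {x : Fin 4 → ℝ} {τ : Finset Root}
    (h : IsVertexAt A x τ) (f : Root) : rootForm f (dehom x) = offDiag A f ↔ f ∈ τ := by
  rw [rootForm_dehom]
  exact ⟨fun hf => by_contra fun hn => (h.slack f hn).ne' hf, h.tight f⟩

namespace IsGenericStar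

variable {A : Matrix (Fin 4) (Fin 4) ℝ}

/-- Every clique lies in the set of inequalities tight at one of the known vertices. -/
theorem exists_isVertexAt (h : IsGenericStar A) {σ : Finset Root}
    (hσ : (patternOf A).graph.IsClique (σ : Set Root)) :
    ∃ x τ, σ ⊆ τ ∧ IsVertexAt A x τ ∧ ((∃ k, x = fun m => -A k m) ∨ (∃ i, x = A.col i) ∨
      ∃ k i l j, (k ≠ l ∧ i ≠ j ∧ k ≠ i ∧ k ≠ j ∧ l ≠ i ∧ l ≠ j) ∧
        A k j + A l i < A k i + A l j ∧ x = halfPoint A k i l j) := by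
  rcases (patternOf A).clique_cases hσ with ⟨k, hk⟩ | ⟨i, hi⟩ | ⟨k, i, l, j, hd, ht, hm⟩
  · exact ⟨_, _, fun f hf => by simpa [starSet] using hk f hf, h.isVertexAt_star k,
      Or.inl ⟨k, rfl⟩⟩
  · exact ⟨_, _, fun f hf => by simpa [costarSet] using hi f hf, h.isVertexAt_costar i,
      Or.inr (Or.inl ⟨i, rfl⟩)⟩
  · have hlt := (h.lineType_eq_iff k i l j hd.1 hd.2.1 hd.2.2.1 hd.2.2.2.1 hd.2.2.2.2.1
      hd.2.2.2.2.2).1 ht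
    exact ⟨_, _, fun f hf => by simpa [halfSet] using hm f hf, h.isVertexAt_half hd hlt,
      Or.inr (Or.inr ⟨k, i, l, j, hd, hlt, rfl⟩)⟩

/-- The span is a simple polytope whose dual complex is given by the pattern of the star. -/
theorem isSimplePolyhedron (h : IsGenericStar A) :
    IsSimplePolyhedron rootForm (offDiag A) (patternOf A).graph := by
  refine ⟨fun y hy f g => h.adj_of_tight hy f g, fun σ hσ => ?_⟩
  obtain ⟨x, τ, hs, hx, -⟩ := h.exists_isVertexAt hσ
  exact ⟨τ, hs, fun f hf g hg hfg => h.adj_of_tight hx.mem_polyhedron f g hfg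
    ((hx.tight_iff f).2 hf) ((hx.tight_iff g).2 hg), hx.existsUnique, dehom x, hx.mem_polyhedron,
    hx.tight_iff⟩

theorem mem_extremePoints_of_isVertexAt (h : IsGenericStar A) {x : Fin 4 → ℝ} {τ : Finset Root}
    (hx : IsVertexAt A x τ) :
    dehom x ∈ Set.extremePoints ℝ (polyhedron rootForm (offDiag A)) := by
  have h0 := polyhedronFace_empty rootForm (offDiag A)
  rw [← h0, h.isSimplePolyhedron.mem_extremePoints_face_iff, h0]
  refine ⟨hx.mem_polyhedron, τ, ?_, hx.tight_iff⟩
  exact h.isSimplePolyhedron.card_of_existsUnique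
    (h.isSimplePolyhedron.isClique_tight hx.mem_polyhedron fun f => (hx.tight_iff f).2)
    hx.existsUnique

theorem extremePoints_eq (h : IsGenericStar A) :
    Set.extremePoints ℝ (polyhedron rootForm (offDiag A)) =
      Set.range (fun i => dehom (A.col i)) ∪ Set.range (fun k => dehom fun m => -A k m) ∪
      {v | ∃ k i l j, (k ≠ l ∧ i ≠ j ∧ k ≠ i ∧ k ≠ j ∧ l ≠ i ∧ l ≠ j) ∧
        A k j + A l i < A k i + A l j ∧ v = dehom (halfPoint A k i l j)} := by
  have h0 := polyhedronFace_empty rootForm (offDiag A)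
  ext v
  constructor
  · rw [← h0, h.isSimplePolyhedron.mem_extremePoints_face_iff, h0]
    rintro ⟨hv, σ, hc, hσ⟩
    have hcl := h.isSimplePolyhedron.isClique_tight hv fun f => (hσ f).2
    obtain ⟨x, τ, hs, hx, hcase⟩ := h.exists_isVertexAt hcl
    have hcτ := h.isSimplePolyhedron.card_of_existsUnique
      (h.isSimplePolyhedron.isClique_tight hx.mem_polyhedron fun f => (hx.tight_iff f).2)
      hx.existsUnique
    obtain rfl : σ = τ := Finset.eq_of_subset_of_card_le hs (by omega)
    obtain rfl : v = dehom x := (hx.existsUnique (offDiag A)).unique (fun f => (hσ f).2)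
      fun f => (hx.tight_iff f).2
    rcases hcase with ⟨k, rfl⟩ | ⟨i, rfl⟩ | ⟨k, i, l, j, hd, hlt, rfl⟩
    · exact Or.inl (Or.inr ⟨k, rfl⟩)
    · exact Or.inl (Or.inl ⟨i, rfl⟩)
    · exact Or.inr ⟨k, i, l, j, hd, hlt, rfl⟩
  · rintro ((⟨i, rfl⟩ | ⟨k, rfl⟩) | ⟨k, i, l, j, hd, hlt, rfl⟩)
    · exact h.mem_extremePoints_of_isVertexAt (h.isVertexAt_costar i)
    · exact h.mem_extremePoints_of_isVertexAt (h.isVertexAt_star k)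
    · exact h.mem_extremePoints_of_isVertexAt (h.isVertexAt_half hd hlt)

end IsGenericStar

/-! ### Tropical planes, tropical lines and extremals -/

/-- The tropical determinant does not change when rows and columns are permuted. -/
theorem tropDet_submatrix_perm {n : ℕ} (M : Matrix (Fin n) (Fin n) ℝ) (e f : Equiv.Perm (Fin n)) :
    tropDet (M.submatrix e f) = tropDet M := by
  have key : ∀ (M : Matrix (Fin n) (Fin n) ℝ) (e f : Equiv.Perm (Fin n)),
      tropDet (M.submatrix e f) ≤ tropDet M := by
    intro M e f
    refine Finset.sup'_le _ _ fun s _ => ?_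
    refine Finset.le_sup'_of_le _ (Finset.mem_univ (e⁻¹.trans (s.trans f) : Equiv.Perm (Fin n))) ?_
    refine le_of_eq ?_
    have := Equiv.sum_comp e fun i => M i (f (s (e.symm i)))
    simpa using this
  refine le_antisymm (key _ _ _) ?_
  have := key (M.submatrix e f) e⁻¹ f⁻¹
  simpa [Matrix.submatrix_submatrix] using this

theorem perm_fin_three : ∀ s : Equiv.Perm (Fin 3),
    (s 0 = 0 ∧ s 1 = 1 ∧ s 2 = 2) ∨ (s 0 = 0 ∧ s 1 = 2 ∧ s 2 = 1) ∨
    (s 0 = 1 ∧ s 1 = 0 ∧ s 2 = 2) ∨ (s 0 = 1 ∧ s 1 = 2 ∧ s 2 = 0) ∨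
    (s 0 = 2 ∧ s 1 = 0 ∧ s 2 = 1) ∨ (s 0 = 2 ∧ s 1 = 1 ∧ s 2 = 0) := by decide

theorem exists_succAbove_perm : ∀ j b c d : Fin 4, b ≠ c → b ≠ d → c ≠ d → j ≠ b → j ≠ c → j ≠ d →
    ∃ e : Equiv.Perm (Fin 3), j.succAbove (e 0) = b ∧ j.succAbove (e 1) = c ∧
      j.succAbove (e 2) = d := by
  have key : ∀ j b : Fin 4, j ≠ b → ∃ b', j.succAbove b' = b := fun j b h =>
    Fin.exists_succAbove_eq h.symm
  intro j b c d hbc hbd hcd hjb hjc hjd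
  obtain ⟨b', rfl⟩ := key j b hjb
  obtain ⟨c', rfl⟩ := key j c hjc
  obtain ⟨d', rfl⟩ := key j d hjd
  have h1 : b' ≠ c' := fun h => hbc (by rw [h])
  have h2 : b' ≠ d' := fun h => hbd (by rw [h])
  have h3 : c' ≠ d' := fun h => hcd (by rw [h])
  have : ∀ b c d : Fin 3, b ≠ c → b ≠ d → c ≠ d → ∃ e : Equiv.Perm (Fin 3), e 0 = b ∧ e 1 = c ∧
      e 2 = d := by decide
  obtain ⟨e, rfl, rfl, rfl⟩ := this b' c' d' h1 h2 h3
  exact ⟨e, rfl, rfl, rfl⟩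

theorem exists_compl_three : ∀ i : Fin 4, ∃ b c d,
    b ≠ c ∧ b ≠ d ∧ c ≠ d ∧ i ≠ b ∧ i ≠ c ∧ i ≠ d := by decide

/-- A cofactor of a Kleene star is the corresponding entry of the star. -/
theorem IsGenericStar.tropDet_cofactor {A : Matrix (Fin 4) (Fin 4) ℝ} (h : IsGenericStar A)
    (i l : Fin 4) : tropDet (A.submatrix i.succAbove l.succAbove) = A l i := by
  have h0 := h.diag
  have ht := h.isKleeneStar.triangle
  have key : ∀ (a b c a' b' c' : Fin 4), a ≠ b → a ≠ c → b ≠ c → i ≠ a → i ≠ b → i ≠ c →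
      a' ≠ b' → a' ≠ c' → b' ≠ c' → l ≠ a' → l ≠ b' → l ≠ c' →
      A a a' + A b b' + A c c' = A l i →
      (A a a' + A b c' + A c b' ≤ A l i) → (A a b' + A b a' + A c c' ≤ A l i) →
      (A a b' + A b c' + A c a' ≤ A l i) → (A a c' + A b a' + A c b' ≤ A l i) →
      (A a c' + A b b' + A c a' ≤ A l i) →
      tropDet (A.submatrix i.succAbove l.succAbove) = A l i := by
    intro a b c a' b' c' h1 h2 h3 h4 h5 h6 h1' h2' h3' h4' h5' h6' e1 e2 e3 e4 e5 e6
    obtain ⟨e, rfl, rfl, rfl⟩ := exists_succAbove_perm i a b c h1 h2 h3 h4 h5 h6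
    obtain ⟨f, rfl, rfl, rfl⟩ := exists_succAbove_perm l a' b' c' h1' h2' h3' h4' h5' h6'
    rw [← tropDet_submatrix_perm _ e f]
    refine le_antisymm (Finset.sup'_le _ _ fun s _ => ?_) ?_
    · rcases perm_fin_three s with ⟨s0, s1, s2⟩ | ⟨s0, s1, s2⟩ | ⟨s0, s1, s2⟩ | ⟨s0, s1, s2⟩ |
        ⟨s0, s1, s2⟩ | ⟨s0, s1, s2⟩ <;>
      simp only [Fin.sum_univ_three, Matrix.submatrix_apply, s0, s1, s2] <;> linarith
    · refine Finset.le_sup'_of_le _ (Finset.mem_univ 1) ?_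
      simp only [Fin.sum_univ_three, Matrix.submatrix_apply, Equiv.Perm.one_apply]
      linarith
  by_cases hil : i = l
  · subst hil
    obtain ⟨b, c, d, h1, h2, h3, h4, h5, h6⟩ := exists_compl_three i
    have t1 := ht b c b
    have t2 := ht b d b
    have t3 := ht c d c
    have t4 := ht b c d
    have t5 := ht b d c
    refine key b c d b c d h1 h2 h3 h4 h5 h6 h1 h2 h3 h4 h5 h6 ?_ ?_ ?_ ?_ ?_ ?_ <;>
    linarith [h0 i, h0 b, h0 c, h0 d]
  · obtain ⟨c, d, h1, h2, h3, h4, h5⟩ := exists_compl i l hil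
    have t1 := ht l c i
    have t2 := ht l d i
    have t3 := ht c d c
    have t4 := ht c d i
    have t5 := ht d c i
    refine key l c d i c d h2.symm h4.symm h5 hil h1.symm h3.symm h1.symm h3.symm h5 (Ne.symm hil)
      h2.symm h4.symm ?_ ?_ ?_ ?_ ?_ ?_ <;>
    linarith [h0 c, h0 d]

theorem minor_eq (p q : Fin 4 → ℝ) (a b : Fin 4) :
    minor p q a b = max (p a + q b) (q a + p b) := by
  simp [minor, tropDet_fin_two]

theorem minor_comm (p q : Fin 4 → ℝ) (a b : Fin 4) : minor p q a b = minor p q b a := by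
  rw [minor_eq, minor_eq, max_comm, add_comm, add_comm (p a)]

theorem maxAttainedTwice_three (f : Fin 3 → ℝ) : MaxAttainedTwice f ↔
    (f 0 = f 1 ∧ f 2 ≤ f 0) ∨ (f 0 = f 2 ∧ f 1 ≤ f 0) ∨ (f 1 = f 2 ∧ f 0 ≤ f 1) := by
  constructor
  · rintro ⟨i, j, hij, he, hm⟩
    have m0 := hm 0
    have m1 := hm 1
    have m2 := hm 2
    fin_cases i <;> fin_cases j <;> simp at hij he m0 m1 m2 <;> grind
  · rintro (⟨h1, h2⟩ | ⟨h1, h2⟩ | ⟨h1, h2⟩)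
    · exact ⟨0, 1, by decide, h1, by simp [Fin.forall_fin_succ, h2, h1.ge]⟩
    · exact ⟨0, 2, by decide, h1, by simp [Fin.forall_fin_succ, h2, h1.ge]⟩
    · exact ⟨1, 2, by decide, h1, by simp [Fin.forall_fin_succ, h2, h1.ge]⟩

theorem maxAttainedTwice_comp {n : ℕ} (f : Fin n → ℝ) (e : Equiv.Perm (Fin n)) :
    MaxAttainedTwice (f ∘ e) ↔ MaxAttainedTwice f := by
  constructor
  · rintro ⟨i, j, hij, he, hm⟩
    exact ⟨e i, e j, e.injective.ne hij, he, fun k => by simpa using hm (e.symm k)⟩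
  · rintro ⟨i, j, hij, he, hm⟩
    exact ⟨e.symm i, e.symm j, e.symm.injective.ne hij, by simpa using he,
      fun k => by simpa using hm (e k)⟩

theorem succAbove_pair : ∀ (j : Fin 4) (i i' i'' : Fin 3), i ≠ i' → i ≠ i'' → i' ≠ i'' →
    (j.succAbove (i.succAbove 0) = j.succAbove i' ∧
      j.succAbove (i.succAbove 1) = j.succAbove i'') ∨
    (j.succAbove (i.succAbove 0) = j.succAbove i'' ∧
      j.succAbove (i.succAbove 1) = j.succAbove i') := by
  decide

theorem expansionTerm_eq (p q x : Fin 4 → ℝ) (j : Fin 4) {i i' i'' : Fin 3} (h1 : i ≠ i')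
    (h2 : i ≠ i'') (h3 : i' ≠ i'') : expansionTerm p q x j i =
      x (j.succAbove i) + minor p q (j.succAbove i') (j.succAbove i'') := by
  rw [expansionTerm]
  rcases succAbove_pair j i i' i'' h1 h2 h3 with ⟨e1, e2⟩ | ⟨e1, e2⟩
  · rw [e1, e2]
  · rw [e1, e2, minor_comm]

theorem maxAttainedTwice_expansion (p q x : Fin 4 → ℝ) {j b c d : Fin 4}
    (hd : b ≠ c ∧ b ≠ d ∧ c ≠ d ∧ j ≠ b ∧ j ≠ c ∧ j ≠ d) :
    MaxAttainedTwice (expansionTerm p q x j) ↔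
      (x b + minor p q c d = x c + minor p q b d ∧ x d + minor p q b c ≤ x b + minor p q c d) ∨
      (x b + minor p q c d = x d + minor p q b c ∧ x c + minor p q b d ≤ x b + minor p q c d) ∨
      (x c + minor p q b d = x d + minor p q b c ∧ x b + minor p q c d ≤ x c + minor p q b d) := by
  obtain ⟨e, rfl, rfl, rfl⟩ := exists_succAbove_perm j b c d hd.1 hd.2.1 hd.2.2.1 hd.2.2.2.1
    hd.2.2.2.2.1 hd.2.2.2.2.2
  have n1 : e 0 ≠ e 1 := e.injective.ne (by decide)
  have n2 : e 0 ≠ e 2 := e.injective.ne (by decide)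
  have n3 : e 1 ≠ e 2 := e.injective.ne (by decide)
  rw [← maxAttainedTwice_comp _ e, maxAttainedTwice_three]
  simp only [Function.comp_apply]
  rw [expansionTerm_eq p q x j n1 n2 n3, expansionTerm_eq p q x j n1.symm n3 n2,
    expansionTerm_eq p q x j n2.symm n3.symm n1]

/-- The condition, apart from lying on the line, for a point to lie on the `j`-th ray. -/
theorem expansion_const_iff (p q x : Fin 4 → ℝ) {j b c d : Fin 4}
    (hd : b ≠ c ∧ b ≠ d ∧ c ≠ d ∧ j ≠ b ∧ j ≠ c ∧ j ≠ d) :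
    (∀ i i', expansionTerm p q x j i = expansionTerm p q x j i') ↔
      x b + minor p q c d = x c + minor p q b d ∧ x b + minor p q c d = x d + minor p q b c := by
  obtain ⟨e, rfl, rfl, rfl⟩ := exists_succAbove_perm j b c d hd.1 hd.2.1 hd.2.2.1 hd.2.2.2.1
    hd.2.2.2.2.1 hd.2.2.2.2.2
  have n1 : e 0 ≠ e 1 := e.injective.ne (by decide)
  have n2 : e 0 ≠ e 2 := e.injective.ne (by decide)
  have n3 : e 1 ≠ e 2 := e.injective.ne (by decide)
  rw [← expansionTerm_eq p q x j n1 n2 n3, ← expansionTerm_eq p q x j n1.symm n3 n2,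
    ← expansionTerm_eq p q x j n2.symm n3.symm n1]
  constructor
  · exact fun h => ⟨h _ _, h _ _⟩
  · rintro ⟨h1, h2⟩
    have key : ∀ i, expansionTerm p q x j i = expansionTerm p q x j (e 0) := by
      intro i
      obtain ⟨i, rfl⟩ := e.surjective i
      fin_cases i
      · rfl
      · exact h1.symm
      · exact h2.symm
    exact fun i i' => (key i).trans (key i').symm

namespace IsGenericStar

variable {A : Matrix (Fin 4) (Fin 4) ℝ}

/-- The minors of the columns `i` and `j`. -/
theorem minor_col (h : IsGenericStar A) {k i l j : Fin 4}
    (hd : k ≠ l ∧ i ≠ j ∧ k ≠ i ∧ k ≠ j ∧ l ≠ i ∧ l ≠ j) (hlt : A k j + A l i < A k i + A l j) :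
    minor (A.col i) (A.col j) i j = 0 ∧ minor (A.col i) (A.col j) i k = A k j ∧
    minor (A.col i) (A.col j) i l = A l j ∧ minor (A.col i) (A.col j) j k = A k i ∧
    minor (A.col i) (A.col j) j l = A l i ∧ minor (A.col i) (A.col j) k l = A k i + A l j := by
  obtain ⟨h1, h2, h3, h4, h5, h6⟩ := hd
  have d1 := h.diag i
  have d2 := h.diag j
  simp only [minor_eq, Matrix.col_apply, d1, d2]
  have t1 := h.triangle i j i h2 h2.symm
  have t2 := h.triangle k i j h3 h2
  have t3 := h.triangle l i j h5 h2
  have t4 := h.triangle k j i h4 h2.symm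
  have t5 := h.triangle l j i h6 h2.symm
  refine ⟨?_, ?_, ?_, ?_, ?_, ?_⟩
  · rw [max_eq_left] <;> linarith
  · rw [max_eq_left] <;> linarith
  · rw [max_eq_left] <;> linarith
  · rw [max_eq_right] <;> linarith
  · rw [max_eq_right] <;> linarith
  · rw [max_eq_left]; linarith

theorem halfPoint_apply {k i l j : Fin 4} (hd : k ≠ l ∧ i ≠ j ∧ k ≠ i ∧ k ≠ j ∧ l ≠ i ∧ l ≠ j) :
    halfPoint A k i l j k = 0 ∧ halfPoint A k i l j i = -A k i ∧
    halfPoint A k i l j j = -A k j ∧ halfPoint A k i l j l = A l j - A k j := by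
  obtain ⟨h1, h2, h3, h4, h5, h6⟩ := hd
  simp [halfPoint, h3.symm, h4.symm, h2.symm, h1.symm, h5, h6]

theorem mem_tropLine_iff (p q x : Fin 4 → ℝ) {k i l j : Fin 4}
    (hd : k ≠ l ∧ i ≠ j ∧ k ≠ i ∧ k ≠ j ∧ l ≠ i ∧ l ≠ j) :
    x ∈ tropLine p q ↔ MaxAttainedTwice (expansionTerm p q x k) ∧
      MaxAttainedTwice (expansionTerm p q x i) ∧ MaxAttainedTwice (expansionTerm p q x l) ∧
      MaxAttainedTwice (expansionTerm p q x j) := by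
  constructor
  · exact fun h => ⟨h _, h _, h _, h _⟩
  · rintro ⟨h1, h2, h3, h4⟩ m
    rcases mem_four k i l j hd.1 hd.2.1 hd.2.2.1 hd.2.2.2.1 hd.2.2.2.2.1 hd.2.2.2.2.2 m with
      rfl | rfl | rfl | rfl <;> assumption

set_option maxHeartbeats 400000 in
/-- The two vertices of the line `L_ij` are the vertices of the span in the two halves of the
square `{k, l} × {i, j}`. -/
theorem lineVertices_eq (h : IsGenericStar A) {k i l j : Fin 4}
    (hd : k ≠ l ∧ i ≠ j ∧ k ≠ i ∧ k ≠ j ∧ l ≠ i ∧ l ≠ j) (hlt : A k j + A l i < A k i + A l j) :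
    lineVertices (A.col i) (A.col j) =
      {dehom (halfPoint A k i l j), dehom (halfPoint A l j k i)} := by
  obtain ⟨mij, mik, mil, mjk, mjl, mkl⟩ := h.minor_col hd hlt
  have mji := minor_comm (A.col i) (A.col j) j i
  have mki := minor_comm (A.col i) (A.col j) k i
  have mli := minor_comm (A.col i) (A.col j) l i
  have mkj := minor_comm (A.col i) (A.col j) k j
  have mlj := minor_comm (A.col i) (A.col j) l j
  have mlk := minor_comm (A.col i) (A.col j) l k
  rw [mij] at mji
  rw [mik] at mki
  rw [mil] at mli
  rw [mjk] at mkj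
  rw [mjl] at mlj
  rw [mkl] at mlk
  obtain ⟨h1, h2, h3, h4, h5, h6⟩ := id hd
  have Ri := fun x => expansion_const_iff (A.col i) (A.col j) x
    (j := i) (b := j) (c := k) (d := l) (by tauto)
  have Rj := fun x => expansion_const_iff (A.col i) (A.col j) x
    (j := j) (b := i) (c := k) (d := l) (by tauto)
  have Rk := fun x => expansion_const_iff (A.col i) (A.col j) x
    (j := k) (b := i) (c := j) (d := l) (by tauto)
  have Rl := fun x => expansion_const_iff (A.col i) (A.col j) x
    (j := l) (b := i) (c := j) (d := k) (by tauto)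
  have Mi := fun x => maxAttainedTwice_expansion (A.col i) (A.col j) x
    (j := i) (b := j) (c := k) (d := l) (by tauto)
  have Mj := fun x => maxAttainedTwice_expansion (A.col i) (A.col j) x
    (j := j) (b := i) (c := k) (d := l) (by tauto)
  have Mk := fun x => maxAttainedTwice_expansion (A.col i) (A.col j) x
    (j := k) (b := i) (c := j) (d := l) (by tauto)
  have Ml := fun x => maxAttainedTwice_expansion (A.col i) (A.col j) x
    (j := l) (b := i) (c := j) (d := k) (by tauto)
  simp only [mij, mik, mil, mjk, mjl, mkl] at Ri Rj Rk Rl Mi Mj Mk Ml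
  obtain ⟨pk, pi, pj, pl⟩ := halfPoint_apply (A := A) hd
  obtain ⟨ql, qj, qi, qk⟩ := halfPoint_apply (A := A) (k := l) (i := j) (l := k) (j := i) (by tauto)
  have hmem := mem_four k i l j h1 h2 h3 h4 h5 h6
  apply Set.Subset.antisymm
  · rintro _ ⟨x, ⟨a, b, hab, ⟨-, ha⟩, ⟨-, hb⟩⟩, rfl⟩
    -- Only the rays `i`, `k` and the rays `j`, `l` meet.
    have key : (x j - x i = A k i - A k j ∧ x l - x i = A k i + A l j - A k j ∧ x k - x i = A k i) ∨
        (x k - x i = A k i ∧ x l - x i = A l i ∧ x j - x i = A l i - A l j) := by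
      rcases hmem a with rfl | rfl | rfl | rfl <;> rcases hmem b with rfl | rfl | rfl | rfl <;>
      first
        | exact absurd rfl hab
        | (simp only [Ri, Rj, Rk, Rl] at ha hb
           obtain ⟨ha, ha'⟩ := ha
           obtain ⟨hb, hb'⟩ := hb
           first
            | (exfalso; linarith)
            | (left; refine ⟨?_, ?_, ?_⟩ <;> linarith)
            | (right; refine ⟨?_, ?_, ?_⟩ <;> linarith))
    rcases key with ⟨e1, e2, e3⟩ | ⟨e1, e2, e3⟩
    · left
      refine dehom_congr (x k) fun p => ?_
      rcases hmem p with rfl | rfl | rfl | rfl <;> simp only [pk, pi, pj, pl] <;> linarith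
    · right
      refine dehom_congr (x l) fun p => ?_
      rcases hmem p with rfl | rfl | rfl | rfl <;> simp only [qk, qi, qj, ql] <;> linarith
  · have tP : halfPoint A k i l j ∈ tropLine (A.col i) (A.col j) := by
      rw [mem_tropLine_iff _ _ _ hd, Mi, Mj, Mk, Ml, pk, pi, pj, pl]
      refine ⟨?_, ?_, ?_, ?_⟩ <;> first
        | (left; constructor <;> linarith)
        | (right; left; constructor <;> linarith)
        | (right; right; constructor <;> linarith)
    have tQ : halfPoint A l j k i ∈ tropLine (A.col i) (A.col j) := by
      rw [mem_tropLine_iff _ _ _ hd, Mi, Mj, Mk, Ml, qk, qi, qj, ql]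
      refine ⟨?_, ?_, ?_, ?_⟩ <;> first
        | (left; constructor <;> linarith)
        | (right; left; constructor <;> linarith)
    rintro v (rfl | rfl)
    · refine ⟨_, ⟨j, l, h6.symm, ⟨tP, ?_⟩, ⟨tP, ?_⟩⟩, rfl⟩
      · rw [Rj, pi, pk, pl]; constructor <;> ring
      · rw [Rl, pi, pk, pj]; constructor <;> ring
    · refine ⟨_, ⟨i, k, h3.symm, ⟨tQ, ?_⟩, ⟨tQ, ?_⟩⟩, rfl⟩
      · rw [Ri, qj, qk, ql]; constructor <;> ring
      · rw [Rk, qi, qj, ql]; constructor <;> ring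

/-- For one order of the two remaining indices the larger diagonal is that through `(k, i)`. -/
theorem exists_square (h : IsGenericStar A) {i j : Fin 4} (hij : i ≠ j) :
    ∃ k l, (k ≠ l ∧ i ≠ j ∧ k ≠ i ∧ k ≠ j ∧ l ≠ i ∧ l ≠ j) ∧ A k j + A l i < A k i + A l j := by
  obtain ⟨k, l, h1, h2, h3, h4, h5⟩ := exists_compl i j hij
  rcases lt_or_gt_of_ne (h.square k i l j h5 hij h1 h2 h3 h4) with hlt | hlt
  · exact ⟨l, k, ⟨h5.symm, hij, h3, h4, h1, h2⟩, by linarith⟩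
  · exact ⟨k, l, ⟨h5, hij, h1, h2, h3, h4⟩, hlt⟩

theorem extremals_eq (h : IsGenericStar A) :
    Set.extremePoints ℝ (polyhedron rootForm (offDiag A)) = extremals A := by
  have h1 : ∀ k, planeVertex A k = dehom fun m => -A k m := fun k => by
    unfold planeVertex
    congr 1; ext i
    rw [h.tropDet_cofactor]
  rw [h.extremePoints_eq, extremals]
  congr 1
  · congr 2
    exact funext fun k => (h1 k).symm
  ext v
  constructor
  · rintro ⟨k, i, l, j, hd, hlt, rfl⟩
    exact ⟨i, j, hd.2.1, by rw [h.lineVertices_eq hd hlt]; simp⟩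
  · rintro ⟨i, j, hij, hv⟩
    obtain ⟨k, l, hd, hlt⟩ := h.exists_square hij
    rw [h.lineVertices_eq hd hlt] at hv
    rcases hv with rfl | rfl
    · exact ⟨k, i, l, j, hd, hlt, rfl⟩
    · exact ⟨l, j, k, i, by tauto, by linarith, rfl⟩

/-- The terms of the Plücker relation belong to the partitions of the indices into two pairs. -/
theorem pluckerTerm_pairing (p q : Fin 4 → ℝ) : ∀ a b c d : Fin 4, a ≠ b → a ≠ c → a ≠ d → b ≠ c →
    b ≠ d → c ≠ d → pluckerTerm p q (pairing a b) = minor p q a b + minor p q c d := by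
  intro a b c d h1 h2 h3 h4 h5 h6
  have m1 := minor_comm p q a b
  have m2 := minor_comm p q c d
  fin_cases a <;> fin_cases b <;> first | exact (h1 rfl).elim | skip
  all_goals fin_cases c <;> first | exact (h2 rfl).elim | exact (h4 rfl).elim | skip
  all_goals
    fin_cases d <;> first | exact (h3 rfl).elim | exact (h5 rfl).elim | exact (h6 rfl).elim | skip
  all_goals
    simp only [pluckerTerm, pairing]
    first
      | rfl
      | exact add_comm _ _
      | (rw [m1]; first | rfl | exact add_comm _ _)
      | (rw [m2]; first | rfl | exact add_comm _ _)
      | (rw [m1, m2]; first | rfl | exact add_comm _ _)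

/-- The pattern records the types of the lines. -/
theorem lType_iff (h : IsGenericStar A) {i j : Fin 4} (hij : i ≠ j) (t : Fin 3) :
    LType A i j t ↔ (patternOf A).lineType i j = t := by
  obtain ⟨k, l, hd, hlt⟩ := h.exists_square hij
  obtain ⟨mij, mik, mil, mjk, mjl, mkl⟩ := h.minor_col hd hlt
  obtain ⟨h1, h2, h3, h4, h5, h6⟩ := hd
  rw [(h.lineType_eq_iff k i l j h1 h2 h3 h4 h5 h6).2 hlt, pairing_comm]
  have e1 := pluckerTerm_pairing (A.col i) (A.col j) i k j l (by tauto) (by tauto) (by tauto)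
    (by tauto) (by tauto) (by tauto)
  have e2 := pluckerTerm_pairing (A.col i) (A.col j) i l j k (by tauto) (by tauto) (by tauto)
    (by tauto) (by tauto) (by tauto)
  have e3 := pluckerTerm_pairing (A.col i) (A.col j) i j k l (by tauto) (by tauto) (by tauto)
    (by tauto) (by tauto) (by tauto)
  rw [mik, mjl] at e1
  rw [mil, mjk] at e2
  rw [mij, mkl] at e3
  have n1 := pairing_ne i k l h3.symm h5.symm h1
  have n2 := pairing_ne i k j h3.symm h2 h4
  have n3 := pairing_ne i l j h5.symm h2 h6
  have gen : ∀ (P : Fin 3 → ℝ) (a b c : Fin 3), a ≠ b → a ≠ c → b ≠ c → P a < P b → P b = P c →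
      ∀ t, (P t < P (t + 1) ∧ P (t + 1) = P (t + 2)) ↔ a = t := by
    intro P a b c hab hac hbc hlt heq t
    have f1 : ∀ x y z : Fin 3, x ≠ y → x ≠ z → y ≠ z →
        (x + 1 = y ∧ x + 2 = z) ∨ (x + 1 = z ∧ x + 2 = y) := by decide
    have f2 : ∀ x y z t : Fin 3, x ≠ y → x ≠ z → y ≠ z → t = x ∨ t = y ∨ t = z := by decide
    rcases f2 a b c t hab hac hbc with rfl | rfl | rfl
    · rcases f1 t b c hab hac hbc with ⟨e1, e2⟩ | ⟨e1, e2⟩ <;> rw [e1, e2] <;>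
      simp [heq] <;> linarith
    · rcases f1 t a c hab.symm hbc hac with ⟨e1, e2⟩ | ⟨e1, e2⟩ <;> rw [e1, e2] <;>
      simp only [hab, iff_false, not_and] <;> intros <;> linarith
    · rcases f1 t a b hac.symm hbc.symm hab with ⟨e1, e2⟩ | ⟨e1, e2⟩ <;> rw [e1, e2] <;>
      simp only [hac, iff_false, not_and] <;> intros <;> linarith
  exact gen _ _ _ _ n1 n2 n3 (by rw [e1, e2]; linarith) (by rw [e2, e3]; ring) t

end IsGenericStar

/-! ### The combinatorial types of the patterns -/

theorem SimpleGraph.Iso.ncard_nCliques {I J : Type*} {G : SimpleGraph I} {G' : SimpleGraph J}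
    (e : G ≃g G') (n : ℕ) (σ : Finset I) :
    {τ : Finset J | G'.IsNClique n τ ∧ σ.map e.toEquiv.toEmbedding ⊆ τ}.ncard =
      {τ : Finset I | G.IsNClique n τ ∧ σ ⊆ τ}.ncard := by
  symm
  refine Set.ncard_congr (fun τ _ => τ.map e.toEquiv.toEmbedding) ?_ ?_ ?_
  · rintro τ ⟨⟨hc, hn⟩, hs⟩
    exact ⟨⟨(e.cliques ⟨τ, hc⟩).2, by rw [Finset.card_map, hn]⟩, Finset.map_subset_map.2 hs⟩
  · intro τ τ' _ _ h
    exact Finset.map_injective _ h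
  · rintro τ ⟨⟨hc, hn⟩, hs⟩
    have h1 : (e.symm.cliques ⟨τ, hc⟩).1.map e.toEquiv.toEmbedding = τ :=
      congrArg Subtype.val (e.cliques.apply_symm_apply ⟨τ, hc⟩)
    refine ⟨(e.symm.cliques ⟨τ, hc⟩).1, ⟨⟨(e.symm.cliques ⟨τ, hc⟩).2, ?_⟩, ?_⟩, h1⟩
    · change (τ.map _).card = n
      rw [Finset.card_map, hn]
    · rwa [← h1, Finset.map_subset_map] at hs

/-- The number of closed walks of length six in `G`: the inner sum counts the walks of length
three from `f` to `g`. -/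
def closedWalkCount {I : Type*} [Fintype I] (G : SimpleGraph I) [DecidableRel G.Adj] : ℕ :=
  ∑ f, ∑ g, (∑ h, ∑ k, if G.Adj f h ∧ G.Adj h k ∧ G.Adj k g then 1 else 0) ^ 2

theorem SimpleGraph.Iso.closedWalkCount_eq {I J : Type*} [Fintype I] [Fintype J]
    {G : SimpleGraph I} {G' : SimpleGraph J} [DecidableRel G.Adj] [DecidableRel G'.Adj]
    (e : G ≃g G') : closedWalkCount G = closedWalkCount G' := by
  unfold closedWalkCount
  rw [← Equiv.sum_comp e.toEquiv]
  refine Finset.sum_congr rfl fun f _ => ?_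
  rw [← Equiv.sum_comp e.toEquiv]
  refine Finset.sum_congr rfl fun g _ => ?_
  rw [← Equiv.sum_comp e.toEquiv]
  congr 1
  refine Finset.sum_congr rfl fun h _ => ?_
  rw [← Equiv.sum_comp e.toEquiv]
  refine Finset.sum_congr rfl fun k _ => ?_
  have key : ∀ x y, G'.Adj (e.toEquiv x) (e.toEquiv y) ↔ G.Adj x y := fun x y => e.map_adj_iff
  simp only [key]

namespace Pattern

/-- A relabelling of the indices that matches two patterns is an isomorphism of dual graphs. -/
def Matches.iso {p : Equiv.Perm (Fin 4)} {s s' : Pattern} (h : Matches p s s') :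
    s.graph ≃g s'.graph := ⟨rootPerm p, fun {f g} => (h f g).symm⟩

theorem exists_matches_rep {s : Pattern} (hs : s.IsGood) {c : TetraClass} (hc : s.InClass c) :
    ∃ p, Matches p (rep c) s := by
  obtain ⟨d, -, hd⟩ := s.exists_inClass_forall_eq hs
  obtain ⟨e, he, hp⟩ := s.exists_inClass_matches_rep hs
  obtain rfl : c = e := (hd c hc).trans (hd e he).symm
  exact hp

theorem cliques_rep : ∀ c, ∀ d : Fin 3,
    (((Finset.univ : Finset Root).powersetCard (3 - d)).filter
      fun t : Finset Root => (rep c).graph.IsClique (t : Set Root)).card =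
    (![20, 30, 12] : Fin 3 → ℕ) d := by decide +kernel

theorem triangles_rep : ∀ c f, (((Finset.univ : Finset Root).powersetCard 3).filter
      fun t : Finset Root => (rep c).graph.IsClique (t : Set Root) ∧ f ∈ t).card =
    (rep c).graph.degree f := by decide +kernel

theorem polygons_rep : ∀ c, ∀ m : Fin 4,
    (Finset.univ.filter fun f => (rep c).graph.degree f = m + 3).card = c.polygons m := by
  decide +kernel

theorem closedWalkCount_rep : ∀ c, closedWalkCount (rep c).graph =
    match c with
    | .class1 => 17784
    | .class2 => 17838
    | .class3 => 17370
    | .class4 => 18384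
    | .class5 => 18588
    | .class6 => 18612 := by decide +kernel

theorem ncard_cliques {s : Pattern} (hs : s.IsGood) (d : Fin 3) :
    {σ : Finset Root | s.graph.IsNClique (3 - d) σ}.ncard = (![20, 30, 12] : Fin 3 → ℕ) d := by
  obtain ⟨c, -, p, hp⟩ := s.exists_inClass_matches_rep hs
  have h1 := hp.iso.ncard_nCliques (3 - d) ∅
  simp only [Finset.map_empty, Finset.empty_subset, and_true] at h1
  rw [h1, ← cliques_rep c d, ← Set.ncard_coe_finset]
  congr 1
  ext t
  simp [SimpleGraph.isNClique_iff, and_comm]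

/-- The triangles at a vertex of the triangulated sphere are as many as its neighbours, since its
link is a cycle. -/
theorem ncard_triangles {s : Pattern} (hs : s.IsGood) (f : Root) :
    {τ : Finset Root | s.graph.IsNClique 3 τ ∧ f ∈ τ}.ncard = s.graph.degree f := by
  obtain ⟨c, -, p, hp⟩ := s.exists_inClass_matches_rep hs
  obtain ⟨f, rfl⟩ := hp.iso.surjective f
  have h1 := hp.iso.ncard_nCliques 3 {f}
  have h2 : (rep c).graph.degree f = s.graph.degree (hp.iso f) := (hp.iso.degree_eq f).symm
  simp only [Finset.map_singleton, Finset.singleton_subset_iff] at h1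
  refine h1.trans ?_
  rw [← h2, ← triangles_rep c f, ← Set.ncard_coe_finset]
  congr 1
  ext t
  simp [SimpleGraph.isNClique_iff]
  tauto

theorem ncard_degree {s : Pattern} (hs : s.IsGood) {c : TetraClass} (hc : s.InClass c) (m : Fin 4) :
    {f | s.graph.degree f = m + 3}.ncard = c.polygons m := by
  obtain ⟨p, hp⟩ := exists_matches_rep hs hc
  rw [← polygons_rep c m, ← Set.ncard_coe_finset]
  symm
  refine Set.ncard_congr (fun f _ => hp.iso f) ?_ (fun _ _ _ _ h => hp.iso.injective h) ?_
  · intro f hf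
    have : (rep c).graph.degree f = m + 3 := by simpa using hf
    change s.graph.degree (hp.iso f) = m + 3
    rw [← this]; exact hp.iso.degree_eq f
  · intro f hf
    refine ⟨hp.iso.symm f, ?_, hp.iso.apply_symm_apply f⟩
    have : s.graph.degree f = m + 3 := hf
    simp only [Finset.coe_filter, Finset.mem_univ, true_and]
    change (rep c).graph.degree (hp.iso.symm f) = m + 3
    rw [← this]; exact hp.iso.symm.degree_eq f

/-- The adjacency graph of the hexagons, from a list of them. -/
theorem nonempty_induce_iso {s : Pattern} {n : ℕ} {H : SimpleGraph (Fin n)} (r : Fin n → Root)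
    (hr : Function.Injective r) (h6 : ∀ f, s.graph.degree f = 6 ↔ ∃ i, r i = f)
    (hadj : ∀ i j, s.graph.Adj (r i) (r j) ↔ H.Adj i j) :
    Nonempty (s.graph.induce {f | s.graph.degree f = 6} ≃g H) := by
  have hb : Function.Bijective fun i =>
      (⟨r i, (h6 _).2 ⟨i, rfl⟩⟩ : {f // f ∈ {f | s.graph.degree f = 6}}) :=
    ⟨fun i j hij => hr (congrArg Subtype.val hij), fun ⟨f, hf⟩ => by
      obtain ⟨i, rfl⟩ := (h6 f).1 hf
      exact ⟨i, rfl⟩⟩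
  exact ⟨(RelIso.mk (Equiv.ofBijective _ hb) fun {i j} => hadj i j : H ≃g _).symm⟩

theorem hexagonPattern_of_rep {P : Set (Fin 3 → ℝ)} : ∀ c : TetraClass,
    Nonempty (hexagonGraph P ≃g (rep c).graph.induce {f | (rep c).graph.degree f = 6}) →
    HexagonPattern P c
  | .class1, ⟨e⟩ => (nonempty_induce_iso
      ![⟨(0, 2), by decide⟩, ⟨(1, 0), by decide⟩, ⟨(2, 1), by decide⟩]
      (by decide) (by decide +kernel) (by decide +kernel)).map e.trans
  | .class2, ⟨e⟩ => (nonempty_induce_iso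
      ![⟨(1, 0), by decide⟩, ⟨(3, 2), by decide⟩, ⟨(2, 1), by decide⟩]
      (by decide) (by decide +kernel)
      (by simp only [SimpleGraph.edge_adj]; decide +kernel)).map e.trans
  | .class3, ⟨e⟩ => (nonempty_induce_iso
      ![⟨(2, 1), by decide⟩, ⟨(3, 0), by decide⟩]
      (by decide) (by decide +kernel) (by decide +kernel)).map e.trans
  | .class4, ⟨e⟩ => (nonempty_induce_iso
      ![⟨(0, 3), by decide⟩, ⟨(2, 1), by decide⟩, ⟨(1, 0), by decide⟩, ⟨(3, 2), by decide⟩]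
      (by decide) (by decide +kernel)
      (by simp only [SimpleGraph.sup_adj, SimpleGraph.edge_adj]; decide +kernel)).map e.trans
  | .class5, ⟨e⟩ => (nonempty_induce_iso
      ![⟨(0, 3), by decide⟩, ⟨(1, 2), by decide⟩, ⟨(3, 0), by decide⟩, ⟨(2, 1), by decide⟩]
      (by decide) (by decide +kernel) (by decide +kernel)).map e.trans
  | .class6, ⟨e⟩ => (nonempty_induce_iso
      ![⟨(0, 3), by decide⟩, ⟨(1, 2), by decide⟩, ⟨(3, 0), by decide⟩, ⟨(2, 1), by decide⟩]
      (by decide) (by decide +kernel) (by decide +kernel)).map e.trans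

/-- The type-vector determines the class, except that classes 2 and 3 share it. -/
theorem types_eq_of_perm : ∀ c d : TetraClass, (∃ p : Equiv.Perm (Fin 3), c.types ∘ p = d.types) →
    c = d ∨ (c = .class2 ∧ d = .class3) ∨ (c = .class3 ∧ d = .class2) := by decide +kernel

theorem InClass.exists_types {s : Pattern} : ∀ {c : TetraClass}, s.InClass c →
    ∃ p : Equiv.Perm (Fin 3), s.typeCount ∘ p = c.types
  | .class1, h => h
  | .class2, ⟨p, hp, _⟩ => ⟨p, hp⟩
  | .class3, ⟨p, hp, _⟩ => ⟨p, hp⟩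
  | .class4, h => h
  | .class5, h => h
  | .class6, h => h

/-- The label of the facet through the point `123` in the plane `X_i = const`. -/
def rootFrom (i : Fin 3) : Root := ⟨(3, i.castSucc), (Fin.castSucc_lt_last i).ne'⟩

/-- The label of the facet through the point `4` in the plane `X_i = const`. -/
def rootTo (i : Fin 3) : Root := ⟨(i.castSucc, 3), (Fin.castSucc_lt_last i).ne⟩

/-- The pair `(i + 1, i - 1)`, with indices modulo 3. It is opposite to `rootFrom i` in the square
of the line `L_{i,i-1}` and to `rootTo i` in that of `L_{4,i-1}`. -/
def rootCycle (i : Fin 3) : Root := ⟨((i + 1).castSucc, (i - 1).castSucc), by revert i; decide⟩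

/-- Reversal of the pairs. -/
def rootSwap (f : Root) : Root := ⟨(f.1.2, f.1.1), f.2.symm⟩

theorem config_class5 (s : Pattern) : s.IsGood → s.InClass .class5 →
    (∃ p : Equiv.Perm (Fin 3), ∀ i, s.graph.degree (rootFrom i) = ![4, 5, 6] (p i)) ∧
    ∃ i j : Fin 3, i ≠ j ∧
      ∀ k, s.graph.degree (rootTo k) = s.graph.degree (rootFrom (Equiv.swap i j k)) := by
  revert s; exact of_forall_bool (by decide +kernel)

theorem config_class6 (s : Pattern) : s.IsGood → s.InClass .class6 →
    (∃ p : Equiv.Perm (Fin 3), ∀ i, s.graph.degree (rootFrom i) = ![4, 5, 6] (p i)) ∧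
    (∀ k, s.graph.degree (rootTo k) = s.graph.degree (rootFrom k)) ∧
    ∃ p : Equiv.Perm (Fin 3), s.typeCount ∘ p = ![4, 2, 0] ∧
      ∃ i j k l : Fin 4, i ≠ j ∧ i ≠ k ∧ i ≠ l ∧ j ≠ k ∧ j ≠ l ∧ k ≠ l ∧
        s.lineType i j = p 1 ∧ s.lineType k l = p 1 := by
  revert s; exact of_forall_bool (by decide +kernel)

/-- A pattern invariant under transposition belongs to class 6. -/
theorem inClass_of_symm (s : Pattern) : s.IsGood →
    (∀ f g, s.graph.Adj f g ↔ s.graph.Adj (rootSwap f) (rootSwap g)) → s.InClass .class6 := by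
  revert s; exact of_forall_bool (by decide +kernel)

/-- The reversed pattern, that of the transpose, arises by an even relabelling except in class 1. -/
theorem chiral_iff (s : Pattern) : s.IsGood →
    ((¬ ∃ p : Equiv.Perm (Fin 4), Equiv.Perm.sign p = 1 ∧ ∀ f g, s.graph.Adj f g ↔
      s.graph.Adj (rootSwap (rootPerm p f)) (rootSwap (rootPerm p g))) ↔ s.InClass .class1) := by
  revert s; exact of_forall_bool (by decide +kernel)

/-- The combinatorial form of left-handedness, for the indices permuted by `p`: the facets at `123`
and `4` are pentagons, and each lies on the diagonal of the square required, so that it contains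
both vertices of the line of that square. -/
def LeftWith (s : Pattern) (p : Equiv.Perm (Fin 4)) : Prop :=
  ∀ i : Fin 3, (s.graph.degree (rootPerm p (rootFrom i)) = 5 ∧
    s.graph.Adj (rootPerm p (rootFrom i)) (rootPerm p (rootCycle i))) ∧
    (s.graph.degree (rootPerm p (rootTo i)) = 5 ∧
    s.graph.Adj (rootPerm p (rootTo i)) (rootPerm p (rootCycle i)))

/-- The combinatorial form of right-handedness, for the indices permuted by `p`. -/
def RightWith (s : Pattern) (p : Equiv.Perm (Fin 4)) : Prop :=
  ∀ i : Fin 3, (s.graph.degree (rootPerm p (rootFrom i)) = 5 ∧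
    s.graph.Adj (rootPerm p (rootFrom i)) (rootPerm p (rootSwap (rootCycle i)))) ∧
    (s.graph.degree (rootPerm p (rootTo i)) = 5 ∧
    s.graph.Adj (rootPerm p (rootTo i)) (rootPerm p (rootSwap (rootCycle i))))

instance (s : Pattern) : DecidablePred s.LeftWith := fun p => by unfold LeftWith; infer_instance
instance (s : Pattern) : DecidablePred s.RightWith := fun p => by unfold RightWith; infer_instance

theorem handed_iff (s : Pattern) : s.IsGood →
    (s.InClass .class1 ↔ (∃ p : Equiv.Perm (Fin 4), Equiv.Perm.sign p = 1 ∧ s.LeftWith p) ∨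
      ∃ p : Equiv.Perm (Fin 4), Equiv.Perm.sign p = 1 ∧ s.RightWith p) := by
  revert s; exact of_forall_bool (by decide +kernel)

theorem not_left_and_right (s : Pattern) : s.IsGood →
    ¬ ((∃ p : Equiv.Perm (Fin 4), Equiv.Perm.sign p = 1 ∧ s.LeftWith p) ∧
      ∃ p : Equiv.Perm (Fin 4), Equiv.Perm.sign p = 1 ∧ s.RightWith p) := by
  revert s; exact of_forall_bool (by decide +kernel)

end Pattern

/-! ### The pattern and the invariants of the span -/

theorem spanFace_eq {A : Matrix (Fin 4) (Fin 4) ℝ} (h : IsKleeneStar A) (f : Root) :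
    spanFace A f.1.1 f.1.2 = polyhedronFace rootForm (offDiag A) {f} := by
  unfold spanFace
  rw [h.tropSpan_eq]
  ext y
  simp [polyhedronFace, rootForm_apply, offDiag]

namespace IsGenericStar

variable {A B : Matrix (Fin 4) (Fin 4) ℝ}

theorem adj_iff (h : IsGenericStar A) (f g : Root) : (patternOf A).graph.Adj f g ↔
    f ≠ g ∧ f.1.1 ≠ g.1.2 ∧ g.1.1 ≠ f.1.2 ∧ (f.1.1 ≠ g.1.1 → f.1.2 ≠ g.1.2 →
      A f.1.1 g.1.2 + A g.1.1 f.1.2 < A f.1.1 f.1.2 + A g.1.1 g.1.2) := by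
  refine and_congr_right fun _ => and_congr_right fun h1 => and_congr_right fun h2 =>
    forall_congr' fun h3 => forall_congr' fun h4 => ?_
  exact h.lineType_eq_iff _ _ _ _ h3 h4 f.2 h1 h2 g.2

theorem submatrix (h : IsGenericStar A) (p : Equiv.Perm (Fin 4)) :
    IsGenericStar (A.submatrix p p) :=
  ⟨fun _ => h.diag _, fun _ _ _ h1 h2 => h.triangle _ _ _ (p.injective.ne h1) (p.injective.ne h2),
    fun _ _ _ _ h1 h2 h3 h4 h5 h6 => h.square _ _ _ _ (p.injective.ne h1) (p.injective.ne h2)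
      (p.injective.ne h3) (p.injective.ne h4) (p.injective.ne h5) (p.injective.ne h6)⟩

theorem transpose (h : IsGenericStar A) : IsGenericStar A.transpose :=
  ⟨fun _ => h.diag _, fun i j k h1 h2 => by
    have := h.triangle k j i h2.symm h1.symm
    simp only [Matrix.transpose_apply]; linarith,
    fun k i l j h1 h2 h3 h4 h5 h6 he => h.square i k j l h2 h1 h3.symm h5.symm h4.symm h6.symm (by
      simp only [Matrix.transpose_apply] at he; linarith)⟩

theorem adj_submatrix_iff (h : IsGenericStar A) (p : Equiv.Perm (Fin 4)) (f g : Root) :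
    (patternOf (A.submatrix p p)).graph.Adj f g ↔
      (patternOf A).graph.Adj (rootPerm p f) (rootPerm p g) := by
  rw [(h.submatrix p).adj_iff, h.adj_iff]
  simp [rootPerm, Subtype.ext_iff, Prod.ext_iff]

theorem adj_transpose_iff (h : IsGenericStar A) (f g : Root) :
    (patternOf A.transpose).graph.Adj f g ↔
      (patternOf A).graph.Adj (Pattern.rootSwap f) (Pattern.rootSwap g) := by
  rw [h.transpose.adj_iff, h.adj_iff]
  simp only [Pattern.rootSwap, Matrix.transpose_apply, ne_eq, Subtype.ext_iff, Prod.ext_iff,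
    and_comm (a := f.1.1 = g.1.1), eq_comm (a := f.1.1) (b := g.1.2),
    eq_comm (a := g.1.1) (b := f.1.2)]
  rw [add_comm (A g.1.2 f.1.1)]
  tauto

theorem degree_submatrix (h : IsGenericStar A) (p : Equiv.Perm (Fin 4)) (f : Root) :
    (patternOf (A.submatrix p p)).graph.degree f =
      (patternOf A).graph.degree (rootPerm p f) := by
  let e : (patternOf (A.submatrix p p)).graph ≃g (patternOf A).graph :=
    ⟨rootPerm p, fun {f g} => (h.adj_submatrix_iff p f g).symm⟩
  exact (e.degree_eq f).symm

theorem degree_transpose (h : IsGenericStar A) (f : Root) :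
    (patternOf A.transpose).graph.degree f =
      (patternOf A).graph.degree (Pattern.rootSwap f) := by
  let e : (patternOf A.transpose).graph ≃g (patternOf A).graph :=
    ⟨⟨Pattern.rootSwap, Pattern.rootSwap, fun _ => rfl, fun _ => rfl⟩,
      fun {f g} => (h.adj_transpose_iff f g).symm⟩
  exact (e.degree_eq f).symm

theorem typeVector_eq (h : IsGenericStar A) : typeVector A = (patternOf A).typeCount := by
  ext s
  rw [typeVector, Pattern.typeCount, ← Set.ncard_coe_finset]
  congr 1
  ext e
  simp only [Set.mem_ofPred_eq, Finset.coe_filter, Finset.mem_univ, true_and]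
  exact and_congr_right fun he => h.lType_iff he.ne s

theorem concatenatedLines_iff (h : IsGenericStar A) (s : Fin 3) : ConcatenatedLines A s ↔
    ∃ i j k : Fin 4, i ≠ j ∧ j ≠ k ∧ i ≠ k ∧ (patternOf A).lineType i j = s ∧
      (patternOf A).lineType j k = s := by
  refine exists_congr fun i => exists_congr fun j => exists_congr fun k =>
    and_congr_right fun h1 => and_congr_right fun h2 => and_congr_right fun _ => ?_
  rw [h.lType_iff h1, h.lType_iff h2]

theorem disjointLines_iff (h : IsGenericStar A) (s : Fin 3) : DisjointLines A s ↔
    ∃ i j k l : Fin 4, i ≠ j ∧ i ≠ k ∧ i ≠ l ∧ j ≠ k ∧ j ≠ l ∧ k ≠ l ∧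
      (patternOf A).lineType i j = s ∧ (patternOf A).lineType k l = s := by
  refine exists_congr fun i => exists_congr fun j => exists_congr fun k => exists_congr fun l =>
    and_congr_right fun h1 => and_congr_right fun _ => and_congr_right fun _ =>
    and_congr_right fun _ => and_congr_right fun _ => and_congr_right fun h2 => ?_
  rw [h.lType_iff h1, h.lType_iff h2]

theorem inClass_iff (h : IsGenericStar A) (c : TetraClass) :
    InClass A c ↔ (patternOf A).InClass c := by
  cases c <;> simp only [InClass, HasTypeVector, Pattern.InClass, h.typeVector_eq,
    h.concatenatedLines_iff, h.disjointLines_iff]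

theorem ncard_triangles (h : IsGenericStar A) (f : Root) :
    {τ : Finset Root | (patternOf A).graph.IsNClique 3 τ ∧ f ∈ τ}.ncard =
      (patternOf A).graph.degree f := Pattern.ncard_triangles h.isGood_patternOf f

theorem point123_apply (h : IsGenericStar A) (i : Fin 3) : point123 A i = -A 3 i.castSucc := by
  rw [point123, planeVertex, dehom, h.tropDet_cofactor, h.tropDet_cofactor, h.diag]; ring

theorem point4_apply (h : IsGenericStar A) (i : Fin 3) : point4 A i = A i.castSucc 3 := by
  simp [point4, generator, dehom, h.diag]

/-- The configurations at `123` and `4` are degrees in the dual graph. -/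
theorem configuration_point123 (h : IsGenericStar A) (i : Fin 3) :
    configuration A (point123 A) i = (patternOf A).graph.degree (Pattern.rootFrom i) := by
  rw [← h.isSimplePolyhedron.ncard_extremePoints_facet h.ncard_triangles, configuration,
    ← spanFace_eq h.isKleeneStar]
  congr 2
  ext y
  refine and_congr_right fun _ => ?_
  rw [h.point123_apply]
  simp only [Pattern.rootFrom, homog_castSucc, homog_three]
  constructor <;> intro <;> linarith

theorem configuration_point4 (h : IsGenericStar A) (i : Fin 3) :
    configuration A (point4 A) i = (patternOf A).graph.degree (Pattern.rootTo i) := by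
  rw [← h.isSimplePolyhedron.ncard_extremePoints_facet h.ncard_triangles, configuration,
    ← spanFace_eq h.isKleeneStar]
  congr 2
  ext y
  refine and_congr_right fun _ => ?_
  rw [h.point4_apply]
  simp only [Pattern.rootTo, homog_castSucc, homog_three, sub_zero]

/-- A facet through both vertices of `L_ij` is labelled by an end of the diagonal of the
square of `L_ij`. -/
theorem lineVertices_subset_iff (h : IsGenericStar A) {k i l j : Fin 4}
    (hd : k ≠ l ∧ i ≠ j ∧ k ≠ i ∧ k ≠ j ∧ l ≠ i ∧ l ≠ j) :
    lineVertices (A.col i) (A.col j) ⊆ {y | homog y k - homog y i = A k i} ↔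
      (patternOf A).graph.Adj ⟨(k, i), hd.2.2.1⟩ ⟨(l, j), hd.2.2.2.2.2⟩ := by
  have hadj : (patternOf A).graph.Adj ⟨(k, i), hd.2.2.1⟩ ⟨(l, j), hd.2.2.2.2.2⟩ ↔
      A k j + A l i < A k i + A l j := by
    rw [h.adj_iff]
    obtain ⟨h1, h2, h3, h4, h5, h6⟩ := hd
    simp [h1, h2, h4, h5]
  rw [hadj]
  obtain ⟨pk, pi, pj, pl⟩ := halfPoint_apply (A := A) hd
  constructor
  · intro hs
    by_contra hn
    have hlt : A l j + A k i < A l i + A k j := by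
      have := h.square k i l j hd.1 hd.2.1 hd.2.2.1 hd.2.2.2.1 hd.2.2.2.2.1 hd.2.2.2.2.2
      rcases lt_or_gt_of_ne this with h' | h' <;> linarith
    have hd' : l ≠ k ∧ i ≠ j ∧ l ≠ i ∧ l ≠ j ∧ k ≠ i ∧ k ≠ j := by tauto
    rw [h.lineVertices_eq hd' hlt] at hs
    obtain ⟨q1, q2, q3, q4⟩ := halfPoint_apply (A := A) hd'
    have h1 : homog _ k - homog _ i = A k i := hs (Set.mem_insert _ _)
    rw [homog_dehom, homog_dehom, q2, q4] at h1
    linarith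
  · intro hlt
    rw [h.lineVertices_eq hd hlt]
    obtain ⟨q1, q2, q3, q4⟩ := halfPoint_apply (A := A) (k := l) (i := j) (l := k) (j := i)
      (by tauto)
    rintro v (rfl | rfl)
    · change homog _ k - homog _ i = A k i
      rw [homog_dehom, homog_dehom, pk, pi]; ring
    · change homog _ k - homog _ i = A k i
      rw [homog_dehom, homog_dehom, q3, q4]; ring

theorem castSucc_distinct : ∀ i : Fin 3, (3 : Fin 4) ≠ (i + 1).castSucc ∧
    i.castSucc ≠ (i - 1).castSucc ∧ (3 : Fin 4) ≠ i.castSucc ∧ (3 : Fin 4) ≠ (i - 1).castSucc ∧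
    (i + 1).castSucc ≠ i.castSucc ∧ (i + 1).castSucc ≠ (i - 1).castSucc := by decide

theorem plane_point123 (h : IsGenericStar A) (i : Fin 3) :
    {y : Fin 3 → ℝ | y i = point123 A i} =
      {y | homog y 3 - homog y i.castSucc = A 3 i.castSucc} := by
  ext y
  simp only [Set.mem_ofPred_eq, h.point123_apply, homog_castSucc, homog_three]
  constructor <;> intro <;> linarith

theorem plane_point4 (h : IsGenericStar A) (i : Fin 3) :
    {y : Fin 3 → ℝ | y i = point4 A i} =
      {y | homog y i.castSucc - homog y 3 = A i.castSucc 3} := by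
  ext y
  simp [h.point4_apply, homog_castSucc, homog_three]

theorem left_iff (h : IsGenericStar A) :
    LeftAt123 A ∧ LeftAt4 A ↔ (patternOf A).LeftWith 1 := by
  rw [LeftAt123, LeftAt4, ← forall_and]
  refine forall_congr' fun i => ?_
  have hi := castSucc_distinct i
  rw [h.plane_point123, h.plane_point4, h.configuration_point123, h.configuration_point4,
    h.lineVertices_subset_iff (k := 3) (l := (i + 1).castSucc) (by tauto),
    h.lineVertices_subset_iff (k := i.castSucc) (l := (i + 1).castSucc)
      (by refine ⟨hi.2.2.2.2.1.symm, hi.2.2.2.1, hi.2.2.1.symm, hi.2.1, hi.1.symm, hi.2.2.2.2.2⟩)]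
  rfl

theorem right_iff (h : IsGenericStar A) :
    RightAt123 A ∧ RightAt4 A ↔ (patternOf A).RightWith 1 := by
  rw [RightAt123, RightAt4, ← forall_and]
  refine forall_congr' fun i => ?_
  have hi := castSucc_distinct i
  have hi' : i.castSucc ≠ (i - 1).castSucc := hi.2.1
  have hi'' : (i - 1).castSucc ≠ (i + 1).castSucc := hi.2.2.2.2.2.symm
  rw [h.plane_point123, h.plane_point4, h.configuration_point123, h.configuration_point4,
    h.lineVertices_subset_iff (k := 3) (l := (i - 1).castSucc)
      (by refine ⟨hi.2.2.2.1, hi.2.2.2.2.1.symm, hi.2.2.1, hi.1, hi'.symm, hi''⟩),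
    h.lineVertices_subset_iff (k := i.castSucc) (l := (i - 1).castSucc)
      (by refine ⟨hi', hi.1, hi.2.2.1.symm, hi.2.2.2.2.1.symm, hi.2.2.2.1.symm, hi''⟩)]
  rfl

theorem leftHanded_iff (h : IsGenericStar A) : LeftHanded A ↔
    ∃ p : Equiv.Perm (Fin 4), Equiv.Perm.sign p = 1 ∧ (patternOf A).LeftWith p := by
  refine exists_congr fun p => and_congr_right fun _ => ?_
  rw [(h.submatrix p).left_iff]
  simp only [Pattern.LeftWith, h.degree_submatrix, h.adj_submatrix_iff]
  rfl

theorem rightHanded_iff (h : IsGenericStar A) : RightHanded A ↔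
    ∃ p : Equiv.Perm (Fin 4), Equiv.Perm.sign p = 1 ∧ (patternOf A).RightWith p := by
  refine exists_congr fun p => and_congr_right fun _ => ?_
  rw [(h.submatrix p).right_iff]
  simp only [Pattern.RightWith, h.degree_submatrix, h.adj_submatrix_iff]
  rfl

theorem leftHanded_iff_transpose (h : IsGenericStar A) :
    LeftHanded A ↔ RightHanded A.transpose := by
  rw [h.leftHanded_iff, h.transpose.rightHanded_iff]
  refine exists_congr fun p => and_congr_right fun _ => forall_congr' fun i => ?_
  simp only [h.degree_transpose, h.adj_transpose_iff]
  exact and_comm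

theorem tropSpan_transpose (h : IsGenericStar A) :
    tropSpan A.transpose = (fun y => -y) '' tropSpan A := by
  rw [h.isKleeneStar.tropSpan_eq, h.transpose.isKleeneStar.tropSpan_eq]
  have key : ∀ y f, rootForm f (-y) = rootForm (Pattern.rootSwap f) y := by
    intro y f
    rw [map_neg, rootForm_apply, rootForm_apply, Pattern.rootSwap]; ring
  ext y
  constructor
  · intro hy
    refine ⟨-y, fun f => ?_, neg_neg y⟩
    rw [key]; exact hy (Pattern.rootSwap f)
  · rintro ⟨z, hz, rfl⟩ f
    change _ ≤ rootForm f (-z)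
    rw [key]; exact hz (Pattern.rootSwap f)

theorem coordEquiv_iff (hA : IsGenericStar A) (hB : IsGenericStar B) (p : Equiv.Perm (Fin 4)) :
    CoordEquiv p A B ↔ Pattern.Matches p (patternOf A) (patternOf B) := by
  have sA := fun i j (hij : i ≠ j) => spanFace_eq hA.isKleeneStar ⟨(i, j), hij⟩
  have sB := fun i j (hij : i ≠ j) => spanFace_eq hB.isKleeneStar ⟨(i, j), hij⟩
  dsimp only at sA sB
  unfold CoordEquiv
  rw [hA.isKleeneStar.tropSpan_eq, hB.isKleeneStar.tropSpan_eq]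
  have hne : Nonempty Root := ⟨⟨(0, 1), by decide⟩⟩
  constructor
  · rintro ⟨e, he⟩
    obtain ⟨q, hq⟩ := hA.isSimplePolyhedron.exists_graphIso hB.isSimplePolyhedron e
    have hqp : ∀ f, q f = rootPerm p f := by
      intro f
      apply hB.isSimplePolyhedron.facetOf_injective
      rw [← hq]
      apply Subtype.ext
      have := (he f.1.1 f.1.2 f.2 (facetOf rootForm (offDiag A) f)).1 (sA _ _ f.2).symm
      rw [this, sB _ _ (p.injective.ne f.2)]
      rfl
    intro f g
    rw [← hqp, ← hqp]
    exact q.map_adj_iff.symm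
  · intro hm
    obtain ⟨e, he⟩ := hA.isSimplePolyhedron.exists_orderIso hB.isSimplePolyhedron hm.iso
    refine ⟨e, fun i j hij F => ?_⟩
    rw [sA i j hij, sB _ _ (p.injective.ne hij)]
    have h1 : F.1 = polyhedronFace rootForm (offDiag A) {⟨(i, j), hij⟩} ↔
        F = facetOf rootForm (offDiag A) ⟨(i, j), hij⟩ := by rw [Subtype.ext_iff]; rfl
    have h2 : (e F).1 = polyhedronFace rootForm (offDiag B) {⟨(p i, p j), p.injective.ne hij⟩} ↔
        e F = facetOf rootForm (offDiag B) ⟨(p i, p j), p.injective.ne hij⟩ := by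
      rw [Subtype.ext_iff]; rfl
    rw [h1, h2, ← e.injective.eq_iff, he]
    rfl

theorem isChiral_iff (h : IsGenericStar A) : IsChiral A ↔ InClass A .class1 := by
  rw [h.inClass_iff, ← Pattern.chiral_iff _ h.isGood_patternOf, IsChiral]
  simp only [h.coordEquiv_iff h.transpose, Pattern.Matches, h.adj_transpose_iff]

theorem hexagonPattern_of_inClass (h : IsGenericStar A) {c : TetraClass} (hc : InClass A c) :
    HexagonPattern (tropSpan A) c := by
  rw [h.isKleeneStar.tropSpan_eq]
  obtain ⟨p, hp⟩ := Pattern.exists_matches_rep h.isGood_patternOf ((h.inClass_iff c).1 hc)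
  apply Pattern.hexagonPattern_of_rep
  obtain ⟨e⟩ := h.isSimplePolyhedron.nonempty_hexagonGraph_iso h.ncard_triangles
  refine ⟨e.trans ?_⟩
  refine (RelIso.mk (hp.iso.toEquiv.subtypeEquiv fun f => ?_) ?_).symm
  · change _ = 6 ↔ _ = 6
    rw [← hp.iso.degree_eq f]; rfl
  · rintro ⟨f, hf⟩ ⟨g, hg⟩
    exact hp.iso.map_adj_iff

theorem inClass_unique (h : IsGenericStar A) : ∃! c, InClass A c := by
  obtain ⟨c, hc, hu⟩ := (patternOf A).exists_inClass_forall_eq h.isGood_patternOf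
  exact ⟨c, (h.inClass_iff c).2 hc, fun d hd => hu d ((h.inClass_iff d).1 hd)⟩

theorem inClass_iff_hexagonPattern (h : IsGenericStar A) (c : TetraClass) :
    InClass A c ↔ HasTypeVector A c.types ∧ HexagonPattern (tropSpan A) c := by
  constructor
  · intro hc
    refine ⟨?_, h.hexagonPattern_of_inClass hc⟩
    rw [HasTypeVector, h.typeVector_eq]
    exact ((h.inClass_iff c).1 hc).exists_types
  · rintro ⟨⟨p, hp⟩, hx⟩
    obtain ⟨d, hd, -⟩ := h.inClass_unique
    have hy := h.hexagonPattern_of_inClass hd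
    obtain ⟨q, hq⟩ := ((h.inClass_iff d).1 hd).exists_types
    rw [← h.typeVector_eq] at hq
    have h1 : c.types ∘ (p⁻¹ * q : Equiv.Perm (Fin 3)) = d.types := by
      rw [← hp, ← hq]; ext; simp
    -- Classes 2 and 3 have the same type-vector but different numbers of hexagons.
    rcases Pattern.types_eq_of_perm c d ⟨_, h1⟩ with rfl | ⟨rfl, rfl⟩ | ⟨rfl, rfl⟩
    · exact hd
    · obtain ⟨e⟩ := hx
      obtain ⟨e'⟩ := hy
      have := Fintype.card_congr (e.symm.trans e').toEquiv
      simp at this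
    · obtain ⟨e⟩ := hx
      obtain ⟨e'⟩ := hy
      have := Fintype.card_congr (e.symm.trans e').toEquiv
      simp at this

/-- A centre of symmetry makes `A` symmetric up to a translation, so that complementary lines
have the same type. -/
theorem inClass_of_centrallySymmetric (h : IsGenericStar A)
    (hc : CentrallySymmetric (tropSpan A)) : InClass A .class6 := by
  rw [h.isKleeneStar.tropSpan_eq] at hc
  obtain ⟨c, hc⟩ := hc
  have hle : ∀ f, offDiag A f - offDiag A (Pattern.rootSwap f) ≤ 2 * rootForm f c := by
    intro f
    obtain ⟨y, hy⟩ := h.isSimplePolyhedron.face_nonempty_iff.2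
      (isClique_singleton (patternOf A).graph (Pattern.rootSwap f))
    have h1 := hc y hy.1 f
    have h2 := hy.2 _ (Finset.mem_singleton_self _)
    have h3 : rootForm f y = -rootForm (Pattern.rootSwap f) y := by
      rw [rootForm_apply, rootForm_apply, Pattern.rootSwap]; ring
    rw [map_sub, map_smul, smul_eq_mul, h3, h2] at h1
    linarith
  have heq : ∀ i j, A i j - A j i = 2 * (homog c i - homog c j) := by
    intro i j
    by_cases hij : i = j
    · subst hij; ring
    · have h1 := hle ⟨(i, j), hij⟩
      have h2 := hle ⟨(j, i), Ne.symm hij⟩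
      simp only [offDiag, Pattern.rootSwap, rootForm_apply] at h1 h2
      linarith
  rw [h.inClass_iff]
  apply Pattern.inClass_of_symm _ h.isGood_patternOf
  intro f g
  rw [← h.adj_transpose_iff, h.adj_iff, h.transpose.adj_iff]
  refine and_congr_right fun _ => and_congr_right fun _ => and_congr_right fun _ =>
    forall_congr' fun _ => forall_congr' fun _ => ?_
  have e1 := heq f.1.1 g.1.2
  have e2 := heq g.1.1 f.1.2
  have e3 := heq f.1.1 f.1.2
  have e4 := heq g.1.1 g.1.2
  simp only [Matrix.transpose_apply]
  constructor <;> intro <;> linarith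

/-- Both patterns are relabellings of the representative of the class. -/
theorem exists_coordEquiv (hA : IsGenericStar A) (hB : IsGenericStar B) {c : TetraClass}
    (hcA : InClass A c) (hcB : InClass B c) : ∃ p, CoordEquiv p A B := by
  obtain ⟨p, hp⟩ := Pattern.exists_matches_rep hA.isGood_patternOf ((hA.inClass_iff c).1 hcA)
  obtain ⟨q, hq⟩ := Pattern.exists_matches_rep hB.isGood_patternOf ((hB.inClass_iff c).1 hcB)
  refine ⟨p.symm.trans q, (hA.coordEquiv_iff hB _).2 fun f g => ?_⟩
  obtain ⟨f, rfl⟩ := (rootPerm p).surjective f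
  obtain ⟨g, rfl⟩ := (rootPerm p).surjective g
  rw [← hp f g, hq f g]
  simp [rootPerm]

/-- The number of closed walks of length six in the dual graph separates the six classes. -/
theorem class_eq_of_combEquiv (hA : IsGenericStar A) (hB : IsGenericStar B) {c d : TetraClass}
    (hcA : InClass A c) (hdB : InClass B d) (e : CombEquiv (tropSpan A) (tropSpan B)) : c = d := by
  rw [hA.isKleeneStar.tropSpan_eq, hB.isKleeneStar.tropSpan_eq] at e
  obtain ⟨e⟩ := e
  have hne : Nonempty Root := ⟨⟨(0, 1), by decide⟩⟩
  obtain ⟨r, -⟩ := hA.isSimplePolyhedron.exists_graphIso hB.isSimplePolyhedron e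
  obtain ⟨p, hp⟩ := Pattern.exists_matches_rep hA.isGood_patternOf ((hA.inClass_iff c).1 hcA)
  obtain ⟨q, hq⟩ := Pattern.exists_matches_rep hB.isGood_patternOf ((hB.inClass_iff d).1 hdB)
  have h1 := SimpleGraph.Iso.closedWalkCount_eq ((hp.iso.trans r).trans hq.iso.symm)
  rw [Pattern.closedWalkCount_rep, Pattern.closedWalkCount_rep] at h1
  cases c <;> cases d <;> first | rfl | simp at h1

end IsGenericStar

/-! ### A matrix in each class -/

/-- The pattern of an integral matrix, in a form that computes. -/
def intPattern (M : Matrix (Fin 4) (Fin 4) ℤ) : Pattern where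
  u r := decide (M (r + 1).castSucc r.castSucc + M (r + 2).castSucc 3 <
    M (r + 1).castSucc 3 + M (r + 2).castSucc r.castSucc)
  w r := decide (M 3 (r + 2).castSucc + M r.castSucc (r + 1).castSucc <
    M 3 (r + 1).castSucc + M r.castSucc (r + 2).castSucc)

theorem patternOf_intCast (M : Matrix (Fin 4) (Fin 4) ℤ) :
    patternOf (M.map Int.cast) = intPattern M := by
  simp only [patternOf, intPattern, Matrix.map_apply, Pattern.mk.injEq]
  refine ⟨funext fun r => ?_, funext fun r => ?_⟩ <;>
  · refine decide_eq_decide.2 ?_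
    norm_cast

theorem isGenericStar_intCast {M : Matrix (Fin 4) (Fin 4) ℤ} (h0 : ∀ i, M i i = 0)
    (h1 : ∀ i j k, i ≠ j → j ≠ k → M i j + M j k < M i k)
    (h2 : ∀ k i l j, (k ≠ l ∧ i ≠ j ∧ k ≠ i) ∧ k ≠ j ∧ l ≠ i ∧ l ≠ j →
      M k i + M l j ≠ M k j + M l i) :
    IsGenericStar (M.map Int.cast) := by
  refine ⟨fun i => ?_, fun i j k hij hjk => ?_, fun k i l j e1 e2 e3 e4 e5 e6 => ?_⟩
  · simp [h0]
  · have := h1 i j k hij hjk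
    simp only [Matrix.map_apply]
    exact_mod_cast this
  · have := h2 k i l j ⟨⟨e1, e2, e3⟩, e4, e5, e6⟩
    simp only [Matrix.map_apply]
    exact_mod_cast this

/-- A matrix in each class; the last one is symmetric. -/
def exampleMatrix : TetraClass → Matrix (Fin 4) (Fin 4) ℤ
  | .class1 => !![0, -7, -5, -7; -4, 0, -7, -5; -7, -4, 0, -7; -6, -6, -7, 0]
  | .class2 => !![0, -7, -7, -6; -4, 0, -7, -4; -7, -4, 0, -4; -5, -5, -4, 0]
  | .class3 => !![0, -6, -6, -7; -4, 0, -5, -5; -7, -4, 0, -7; -4, -7, -6, 0]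
  | .class4 => !![0, -4, -5, -4; -4, 0, -5, -5; -5, -4, 0, -5; -4, -5, -4, 0]
  | .class5 => !![0, -7, -7, -6; -5, 0, -4, -7; -6, -5, 0, -5; -6, -6, -7, 0]
  | .class6 => !![0, -4, -5, -4; -4, 0, -4, -5; -5, -4, 0, -5; -4, -5, -5, 0]

theorem isGenericStar_exampleMatrix (c : TetraClass) :
    IsGenericStar ((exampleMatrix c).map Int.cast) := by
  apply isGenericStar_intCast
  · revert c; decide +kernel
  · revert c; decide +kernel
  · revert c; decide +kernel

theorem inClass_exampleMatrix (c : TetraClass) :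
    InClass ((exampleMatrix c).map Int.cast) c := by
  rw [(isGenericStar_exampleMatrix c).inClass_iff, patternOf_intCast]
  revert c; decide +kernel

theorem centrallySymmetric_of_transpose_eq {A : Matrix (Fin 4) (Fin 4) ℝ} (h : IsGenericStar A)
    (hA : A.transpose = A) : CentrallySymmetric (tropSpan A) := by
  refine ⟨0, fun y hy => ?_⟩
  rw [smul_zero, zero_sub, ← hA, h.tropSpan_transpose]
  exact ⟨y, hy, rfl⟩

/-! ### The classification -/

theorem mainTheorem1 :
    -- every admissible solid: convexity, maximality, class and its properties
    (∀ A : Matrix (Fin 4) (Fin 4) ℝ, Admissible A →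
      Convex ℝ (tropSpan A) ∧
      (extremals A).ncard = 20 ∧
      Set.extremePoints ℝ (tropSpan A) = extremals A ∧
      fVector (tropSpan A) = ![20, 30, 12] ∧
      (∃! c : TetraClass, InClass A c) ∧
      (∀ c : TetraClass, InClass A c ↔
        HasTypeVector A c.types ∧ HexagonPattern (tropSpan A) c) ∧
      (∀ c : TetraClass, InClass A c → polygonVector (tropSpan A) = c.polygons) ∧
      -- the configurations at the points `123` and `4` in classes 5 and 6
      (InClass A .class5 →
        (∃ s : Equiv.Perm (Fin 3), configuration A (point123 A) = ![4, 5, 6] ∘ s) ∧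
        ∃ i j : Fin 3, i ≠ j ∧
          configuration A (point4 A) = configuration A (point123 A) ∘ Equiv.swap i j) ∧
      (InClass A .class6 →
        (∃ s : Equiv.Perm (Fin 3), configuration A (point123 A) = ![4, 5, 6] ∘ s) ∧
        configuration A (point4 A) = configuration A (point123 A) ∧
        ∃ s : Equiv.Perm (Fin 3), typeVector A ∘ s = ![4, 2, 0] ∧ DisjointLines A (s 1)) ∧
      -- central symmetry
      (CentrallySymmetric (tropSpan A) → InClass A .class6) ∧
      -- chirality
      tropSpan A.transpose = (fun y => -y) '' tropSpan A ∧
      (IsChiral A ↔ InClass A .class1) ∧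
      (InClass A .class1 ↔ LeftHanded A ∨ RightHanded A) ∧
      ¬ (LeftHanded A ∧ RightHanded A) ∧
      (LeftHanded A ↔ RightHanded A.transpose)) ∧
    -- the classes are exactly the combinatorial types, also up to changes of coordinates
    (∀ A B : Matrix (Fin 4) (Fin 4) ℝ, Admissible A → Admissible B →
      ∀ c d : TetraClass, InClass A c → InClass B d →
        (CombEquiv (tropSpan A) (tropSpan B) ↔ c = d) ∧
        ((∃ s : Equiv.Perm (Fin 4), CoordEquiv s A B) ↔ c = d)) ∧
    -- all six classes occur, and class 6 contains centrally symmetric solids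
    (∀ c : TetraClass, ∃ A : Matrix (Fin 4) (Fin 4) ℝ, Admissible A ∧ InClass A c) ∧
    (∃ A : Matrix (Fin 4) (Fin 4) ℝ,
      Admissible A ∧ InClass A .class6 ∧ CentrallySymmetric (tropSpan A)) := by
  refine ⟨fun A hA => ?_, fun A B hA hB c d hc hd => ⟨⟨?_, ?_⟩, ?_, ?_⟩, fun c => ?_, ?_⟩
  · have h := hA.isGenericStar
    have hP := h.isSimplePolyhedron
    have hgood := h.isGood_patternOf
    have hS := h.isKleeneStar.tropSpan_eq
    have hE := h.extremals_eq
    refine ⟨hS ▸ convex_polyhedron _ _, ?_, by rw [hS, hE], ?_, h.inClass_unique,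
      h.inClass_iff_hexagonPattern, fun c hc => ?_, fun hc => ?_, fun hc => ?_,
      h.inClass_of_centrallySymmetric, h.tropSpan_transpose, h.isChiral_iff, ?_, ?_,
      h.leftHanded_iff_transpose⟩
    · have h0 := polyhedronFace_empty rootForm (offDiag A)
      have h1 := Pattern.ncard_cliques hgood 0
      rw [← hE, ← h0, hP.ncard_extremePoints_face, Module.finrank_fin_fun]
      simpa using h1
    · ext d
      rw [hS, hP.fVector_eq, Pattern.ncard_cliques hgood]
    · ext m
      rw [hS, hP.polygonVector_eq h.ncard_triangles,
        Pattern.ncard_degree hgood ((h.inClass_iff c).1 hc)]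
    · obtain ⟨⟨p, hp⟩, i, j, hij, hk⟩ := Pattern.config_class5 _ hgood ((h.inClass_iff _).1 hc)
      refine ⟨⟨p, funext fun i => ?_⟩, i, j, hij, funext fun k => ?_⟩
      · rw [h.configuration_point123, hp]; rfl
      · rw [h.configuration_point4, hk, Function.comp_apply, h.configuration_point123]
    · obtain ⟨⟨p, hp⟩, hk, q, hq, hl⟩ := Pattern.config_class6 _ hgood ((h.inClass_iff _).1 hc)
      refine ⟨⟨p, funext fun i => ?_⟩, funext fun k => ?_, q, ?_, (h.disjointLines_iff _).2 hl⟩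
      · rw [h.configuration_point123, hp]; rfl
      · rw [h.configuration_point4, hk, h.configuration_point123]
      · rw [h.typeVector_eq, hq]
    · rw [h.inClass_iff, h.leftHanded_iff, h.rightHanded_iff]
      exact Pattern.handed_iff _ hgood
    · rw [h.leftHanded_iff, h.rightHanded_iff]
      exact Pattern.not_left_and_right _ hgood
  · exact hA.isGenericStar.class_eq_of_combEquiv hB.isGenericStar hc hd
  · rintro rfl
    obtain ⟨p, e, -⟩ := hA.isGenericStar.exists_coordEquiv hB.isGenericStar hc hd
    exact ⟨e⟩
  · rintro ⟨p, e, -⟩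
    exact hA.isGenericStar.class_eq_of_combEquiv hB.isGenericStar hc hd ⟨e⟩
  · rintro rfl
    exact hA.isGenericStar.exists_coordEquiv hB.isGenericStar hc hd
  · exact ⟨_, (isGenericStar_exampleMatrix c).admissible, inClass_exampleMatrix c⟩
  · refine ⟨_, (isGenericStar_exampleMatrix .class6).admissible, inClass_exampleMatrix .class6,
      centrallySymmetric_of_transpose_eq (isGenericStar_exampleMatrix .class6) ?_⟩
    rw [← Matrix.transpose_map]
    congr 1
    decide +kernel
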